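/- **Setting.** Let $\mathcal X,\mathcal A,\mathcal O$ be measurable spaces (contexts, actions, observations), $T\ge 1$ a horizon, $d\ge1$, and $\Gamma\subset\mathbb R^d$ a measurable set of positive Lebesgue measure. Each $\gamma\in\Gamma$ is an environment: contexts $X_t$ are i.i.d. from a law $\mathbb P(\cdot)$ that is the same for all $\gamma\in\Gamma$, and given $(X_t,a_t)=(x,a)$ the observation $O_t$ has a positive density $\mathbb P_\gamma(\cdot\mid x,a)$ with respect to a reference measure not depending on $\gamma$. The reward $R_t$ is an integrable function of $(X_t,a_t,O_t)$, $r(x,a;\gamma)$ is its mean given $(x,a)$ in environment $\gamma$, and $a^{(\gamma)*}(x)\in\arg\max_a r(x,a;\gamma)$ is an optimal action (assumed to exist, measurably in $(\gamma,x)$). A history is $H_t=(X_1,a_1,O_1,\dots,X_{t-1},a_{t-1},O_{t-1},X_t)$; a decision function $f$ maps $H_t$ to a (possibly randomized) action. The prior $\mathcal P_\gamma$ is uniform on $\Gamma$, and $\mathcal P(\cdot\mid H_t)$ is the posterior of the environment. $\mathtt{Alg}^*$ is a Bayes-optimal decision function: its output at each history minimizes, over the admissible outputs, the posterior expectation of a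 given loss for predicting $a^{(\gamma')*}(X_t)$. $\mathtt{TF}_{\hat\theta}$ is any decision function, and $\mathrm{Regret}(\mathtt{TF}_{\hat\theta};\gamma)=\mathbb E\big[\sum_{t=1}^T r(X_t,a_t^*;\gamma)-r(X_t,a_t;\gamma)\big]$, where $a_t^*=a^{(\gamma)*}(X_t)$ and the data are generated by $\gamma$ and $a_t=\mathtt{TF}_{\hat\theta}(H_t)$. **Assumptions.** Let $\gamma\in\Gamma$ be the true environment, and let $\bar\gamma,\bar r,C_r,\Delta_{\mathrm{Exploit}}\in\mathbb R$, $C_{\sigma^2}\ge0$, $C_\Gamma>0$ be constants. 1. $\|\gamma'\|_2\le\bar\gamma$ for all $\gamma'\in\Gamma$, where $32\bar\gamma\sqrt d\ge1$; and $r(x,a;\gamma')-r(x,a';\gamma')\le\bar r$ for all $x,a,a'$ and $\gamma'\in\Gamma$ (for instance, $0\le r\le\bar r$). 2. There is a measurable map $\Delta$ from $\mathcal X\times\mathcal A$ to the positive semidefinite $d\times d$ matrices such that, with $\|z\|_{\Delta}^2=z^\top\Delta z$, for all $x,a$ and $\gamma'\in\Gamma$: (a) $\mathrm{KL}\big(\mathbb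 P_\gamma(\cdot|x,a)\,\|\,\mathbb P_{\gamma'}(\cdot|x,a)\big)\ge\|\gamma-\gamma'\|^2_{\Delta(x,a)}$; (b) for $O\sim\mathbb P_\gamma(\cdot|x,a)$ the centered log-likelihood ratio $\log\frac{\mathbb P_\gamma(O|x,a)}{\mathbb P_{\gamma'}(O|x,a)}$ is sub-Gaussian with variance proxy $C_{\sigma^2}\|\gamma-\gamma'\|^2_{\Delta(x,a)}$; (c) for every $o\in\mathcal O$, $\gamma'\mapsto\log\mathbb P_{\gamma'}(o|x,a)$ is concave on $\Gamma$ (in particular $\Gamma$ is convex) and twice differentiable on $\Gamma$, with Hessian of spectral norm at most $C_\Gamma$. 3. For $t=1,\dots,T$ and almost every history $H_t$ generated by $\gamma$ and $\mathtt{TF}_{\hat\theta}$: $\mathbb E[r(X_t,\mathtt{Alg}^*(H_t))-r(X_t,\mathtt{TF}_{\hat\theta}(H_t))\mid H_t]\le\Delta_{\mathrm{Exploit}}$, and $\mathbb E[r(X_t,a_t^*)-r(X_t,\mathtt{Alg}^*(H_t))\mid H_t]\le C_r\,\mathbb E_{\gamma'\sim\mathcal P(\cdot|H_t)}\big[\|\gamma-\gamma'\|_2^2\big]$,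 where $r=r(\cdot,\cdot;\gamma)$. **Notation.** Let $\lambda_t$ be the minimum eigenvalue of $\sum_{\tau=1}^t\Delta(X_\tau,a_\tau)$, let $t_0=\min\{t=2,\dots,T\mid\lambda_{t-1}>0\}$, with $t_0=T+1$ if this set is empty, and for $t\ge t_0$ let $$\epsilon_t=\frac{16d}{\lambda_{t-1}}\log\Big(\frac{32\bar\gamma\sqrt d\,(C_\Gamma(t-1)+\lambda_{t-1})}{\lambda_{t-1}}\Big),\qquad K_t=\max\Big\{1,\Big(\frac{32\bar\gamma\sqrt d\,(C_\Gamma(t-1)+\lambda_{t-1})}{\lambda_{t-1}\min\{\sqrt{\epsilon_t},1\}}\Big)^d\Big\}.$$ **Theorem (Regret Upper Bound).** Under these assumptions, $$\mathrm{Regret}(\mathtt{TF}_{\hat\theta};\gamma)\le\Delta_{\mathrm{Exploit}}T+\bar r\,\mathbb E[t_0-1]+C_r\mathbb E\Big[\sum_{t=t_0}^T\epsilon_t\Big]+16C_r(4C_{\sigma^2}+1)\mathbb E\Big[\sum_{t=t_0}^T\frac{\log(2K_tT)}{\lambda_{t-1}}\Big]+4C_r\bar\gamma^2 .$$ Moreover,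 there is a constant $c>0$, depending only on $\bar\gamma,\bar r,C_r,C_{\sigma^2},C_\Gamma$, such that $$\mathrm{Regret}(\mathtt{TF}_{\hat\theta};\gamma)\le\Delta_{\mathrm{Exploit}}T+c\,\log(2dT)\;\mathbb E\Big[t_0+\sum_{t=t_0}^T\frac d{\lambda_{t-1}}\Big],$$ that is, the regret is $O\big(\Delta_{\mathrm{Exploit}}T+\mathbb E[t_0+\sum_{t\ge t_0}d/\lambda_{t-1}]\big)$ up to a factor logarithmic in $T$ and $d$. Expectations on the right-hand sides may be infinite. -/

import Mathlib

open MeasureTheory ProbabilityTheory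

open scoped ENNReal NNReal

namespace SeqDecision

/-- The parameter space `ℝ^d` with its Euclidean norm. -/
abbrev Param (d : ℕ) : Type := EuclideanSpace ℝ (Fin d)

/-- One completed round `((X_t, a_t), O_t)`. -/
abbrev Round (X A O : Type*) : Type _ := (X × A) × O

/-- A history `H_{n+1} = (X_1, a_1, O_1, …, X_n, a_n, O_n, X_{n+1})`: the `n` completed rounds,
together with the current context. -/
abbrev History (X A O : Type*) (n : ℕ) : Type _ := (Fin n → Round X A O) × X

/-- A family of environments indexed by `γ ∈ Γ ⊆ ℝ^d`. The context law has density `ctxDens γ`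
with respect to `ctxRef`; the law of the observation given `(x, a)` has the positive density
`obsDens γ x a` with respect to a reference measure `obsRef (x, a)` that does not depend on `γ`.
The random reward of a round is read off from that round (`rew x a o`). -/
structure Model (d : ℕ) (X A O : Type*) [MeasurableSpace X] [MeasurableSpace A]
    [MeasurableSpace O] where
  Γ : Set (Param d)
  ctxRef : Measure X
  ctxDens : Param d → X → ℝ
  obsRef : Kernel (X × A) O
  obsDens : Param d → X → A → O → ℝ
  rew : X → A → O → ℝ
  obsRef_sfinite : IsSFiniteKernel obsRef
  ctxDens_measurable : Measurable (fun q : Param d × X => ctxDens q.1 q.2)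
  obsDens_measurable :
    Measurable (fun q : Param d × ((X × A) × O) => obsDens q.1 q.2.1.1 q.2.1.2 q.2.2)
  rew_measurable : Measurable (fun q : (X × A) × O => rew q.1.1 q.1.2 q.2)
  ctxDens_pos : ∀ γ ∈ Γ, ∀ x, 0 < ctxDens γ x
  obsDens_pos : ∀ γ ∈ Γ, ∀ x a o, 0 < obsDens γ x a o
  ctxDens_prob : ∀ γ ∈ Γ, ∫⁻ x, ENNReal.ofReal (ctxDens γ x) ∂ctxRef = 1
  obsDens_prob : ∀ γ ∈ Γ, ∀ x a, ∫⁻ o, ENNReal.ofReal (obsDens γ x a o) ∂(obsRef (x, a)) = 1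
  rew_integrable : ∀ γ ∈ Γ, ∀ x a, Integrable (rew x a)
    ((obsRef (x, a)).withDensity (fun o => ENNReal.ofReal (obsDens γ x a o)))

attribute [instance] Model.obsRef_sfinite

/-- A decision function (possibly randomized): it maps every history to a law on actions. -/
abbrev Policy (X A O : Type*) [MeasurableSpace X] [MeasurableSpace A] [MeasurableSpace O] :
    Type _ :=
  (n : ℕ) → Kernel (History X A O n) A

noncomputable section

variable {d : ℕ} {X A O : Type*} [MeasurableSpace X] [MeasurableSpace A] [MeasurableSpace O]

namespace Model

/-- The law `ℙ_γ(·)` of the contexts. -/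
def ctxLaw (M : Model d X A O) (γ : Param d) : Measure X :=
  M.ctxRef.withDensity (fun x => ENNReal.ofReal (M.ctxDens γ x))

/-- The law `ℙ_γ(· | x, a)` of the observations. -/
def obsLaw (M : Model d X A O) (γ : Param d) : Kernel (X × A) O :=
  Kernel.withDensity M.obsRef (fun xa o => ENNReal.ofReal (M.obsDens γ xa.1 xa.2 o))

/-- The expected reward `r(x, a; γ)`. -/
def meanReward (M : Model d X A O) (γ : Param d) (x : X) (a : A) : ℝ :=
  ∫ o, M.rew x a o ∂(M.obsLaw γ (x, a))

/-- The uniform distribution over `Γ`. -/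
def prior (M : Model d X A O) : Measure (Param d) :=
  ProbabilityTheory.cond volume M.Γ

/-- The law of one round `((X, a), O)` after `n` completed rounds, in environment `γ` and under
the decision function `f`. -/
def roundKernel (M : Model d X A O) (γ : Param d) (f : Policy X A O) (n : ℕ) :
    Kernel (Fin n → Round X A O) (Round X A O) :=
  ((Kernel.const (Fin n → Round X A O) (M.ctxLaw γ)).compProd (f n)).compProd
    (Kernel.comap (M.obsLaw γ) Prod.snd measurable_snd)

/-- The law of the first `n` rounds in environment `γ` under the decision function `f`. -/
def roundsLaw (M : Model d X A O) (γ : Param d) (f : Policy X A O) :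
    (n : ℕ) → Measure (Fin n → Round X A O)
  | 0 => Measure.dirac (fun i => i.elim0)
  | n + 1 => ((M.roundsLaw γ f n).compProd (M.roundKernel γ f n)).map
      (fun q => Fin.snoc (α := fun _ => Round X A O) q.1 q.2)

/-- The law of the history `H_{n+1}`. -/
def historyLaw (M : Model d X A O) (γ : Param d) (f : Policy X A O) (n : ℕ) :
    Measure (History X A O n) :=
  (M.roundsLaw γ f n).prod (M.ctxLaw γ)

/-- The likelihood `ℙ(H | γ)` of a history. -/
def likelihood (M : Model d X A O) {n : ℕ} (h : History X A O n) (γ : Param d) : ℝ :=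
  ((∏ i, M.ctxDens γ (h.1 i).1.1) * M.ctxDens γ h.2) *
    ∏ i, M.obsDens γ (h.1 i).1.1 (h.1 i).1.2 (h.1 i).2

/-- The posterior distribution of the environment given a history. -/
def posterior (M : Model d X A O) {n : ℕ} (h : History X A O n) : Measure (Param d) :=
  (∫⁻ γ, ENNReal.ofReal (M.likelihood h γ) ∂M.prior)⁻¹ •
    M.prior.withDensity (fun γ => ENNReal.ofReal (M.likelihood h γ))

/-- `astar γ x` maximizes the expected reward `r(x, ·; γ)`. -/
structure IsOptimalAction (M : Model d X A O) (astar : Param d → X → A) : Prop where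
  measurable : Measurable (fun q : Param d × X => astar q.1 q.2)
  optimal : ∀ γ ∈ M.Γ, ∀ x a, M.meanReward γ x a ≤ M.meanReward γ x (astar γ x)

/-- `f` is a Bayes-optimal decision function: at every history its output minimizes, over the
set `dec` of admissible outputs, the posterior expected loss of predicting the optimal action.
Outputs are laws on `A`; a loss `l` on `A × A` corresponds to taking for `dec` the point masses,
with `loss (dirac a) a' = l a a'`, and the cross-entropy loss to taking all laws. -/
def IsBayesOptimal (M : Model d X A O) (astar : Param d → X → A) (dec : Set (Measure A))
    (loss : Measure A → A → ℝ≥0∞) (f : Policy X A O) : Prop :=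
  ∀ (n : ℕ) (h : History X A O n), f n h ∈ dec ∧
    ∀ ρ ∈ dec, ∫⁻ γ', loss (f n h) (astar γ' h.2) ∂(M.posterior h) ≤
      ∫⁻ γ', loss ρ (astar γ' h.2) ∂(M.posterior h)

/-- `Regret(f; γ) = 𝔼[∑_{t=1}^T r(X_t, a_t^*) - r(X_t, a_t)]`. -/
def regret (M : Model d X A O) (astar : Param d → X → A) (f : Policy X A O) (γ : Param d)
    (T : ℕ) : ℝ :=
  ∫ ω, ∑ t, (M.meanReward γ (ω t).1.1 (astar γ (ω t).1.1) -
    M.meanReward γ (ω t).1.1 (ω t).1.2) ∂(M.roundsLaw γ f T)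

end Model

/-- `‖z‖²_D = zᵀ D z`. -/
def sqNorm (D : Matrix (Fin d) (Fin d) ℝ) (z : Param d) : ℝ :=
  z.ofLp ⬝ᵥ (D.mulVec z.ofLp)

/-- The minimum eigenvalue of a (symmetric) real matrix. -/
def minEigenvalue (D : Matrix (Fin d) (Fin d) ℝ) : ℝ :=
  sInf (spectrum ℝ D)

/-- `λ_t`, the minimum eigenvalue of `∑_{τ=1}^t Δ(X_τ, a_τ)`. The round with number `τ`
(counted from one) is `ω (τ - 1)`. -/
def lam (Δ : X → A → Matrix (Fin d) (Fin d) ℝ) {T : ℕ} (ω : Fin T → Round X A O) (t : ℕ) : ℝ :=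
  minEigenvalue (∑ i : Fin T, if (i : ℕ) < t then Δ (ω i).1.1 (ω i).1.2 else 0)

/-- `t₀ = min {t = 2, …, T | λ_{t-1} > 0}`, and `T + 1` if there is no such `t`. -/
def tZero (Δ : X → A → Matrix (Fin d) (Fin d) ℝ) {T : ℕ} (ω : Fin T → Round X A O) : ℕ :=
  sInf ({t | 2 ≤ t ∧ t ≤ T ∧ 0 < lam Δ ω (t - 1)} ∪ {T + 1})

/-- `32 γ̄ √d (C_Γ (t - 1) + l) / l`. -/
def coverRatio (d : ℕ) (γbar CΓ : ℝ) (t : ℕ) (l : ℝ) : ℝ :=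
  32 * γbar * √(d : ℝ) * (CΓ * ((t : ℝ) - 1) + l) / l

/-- `ε_t`, as a function of `t` and `l = λ_{t-1}`. -/
def epsT (d : ℕ) (γbar CΓ : ℝ) (t : ℕ) (l : ℝ) : ℝ :=
  16 * (d : ℝ) / l * Real.log (coverRatio d γbar CΓ t l)

/-- `K_t`, as a function of `t` and `l = λ_{t-1}`. -/
def coverT (d : ℕ) (γbar CΓ : ℝ) (t : ℕ) (l : ℝ) : ℝ :=
  max 1 ((32 * γbar * √(d : ℝ) * (CΓ * ((t : ℝ) - 1) + l) /
    (l * min (√(epsT d γbar CΓ t l)) 1)) ^ d)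

/-- The expectation of a nonnegative random variable, with value `⊤` if it is infinite. -/
def expect {Ω : Type*} [MeasurableSpace Ω] (μ : Measure Ω) (f : Ω → ℝ) : EReal :=
  ((∫⁻ ω, ENNReal.ofReal (f ω) ∂μ : ℝ≥0∞) : EReal)

/-- Assumptions on the environment space. Rewards enter through their range only. -/
structure EnvironmentSpace (M : Model d X A O) (γbar rbar : ℝ) : Prop where
  measurableSet : MeasurableSet M.Γ
  volume_ne_zero : volume M.Γ ≠ 0
  norm_le : ∀ γ ∈ M.Γ, ‖γ‖ ≤ γbar
  one_le : 1 ≤ 32 * γbar * √(d : ℝ)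
  reward_le : ∀ γ ∈ M.Γ, ∀ x a a', M.meanReward γ x a - M.meanReward γ x a' ≤ rbar
  ctx_eq : ∀ γ ∈ M.Γ, ∀ γ' ∈ M.Γ, ∀ x, M.ctxDens γ x = M.ctxDens γ' x

/-- The log-likelihood ratio `log (ℙ_γ(o | x, a) / ℙ_γ'(o | x, a))`. -/
def logRatio (M : Model d X A O) (γ γ' : Param d) (x : X) (a : A) (o : O) : ℝ :=
  Real.log (M.obsDens γ x a o / M.obsDens γ' x a o)

/-- The log-likelihood `γ' ↦ log ℙ_γ'(o | x, a)`. -/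
def logLik (M : Model d X A O) (x : X) (a : A) (o : O) (γ' : Param d) : ℝ :=
  Real.log (M.obsDens γ' x a o)

/-- Assumptions on the observation distribution, `γ` being the true environment. -/
structure ObservationModel (M : Model d X A O) (γ : Param d)
    (Δ : X → A → Matrix (Fin d) (Fin d) ℝ) (Cσ : ℝ≥0) (CΓ : ℝ) : Prop where
  measurable : ∀ i j, Measurable (fun q : X × A => Δ q.1 q.2 i j)
  posSemidef : ∀ x a, (Δ x a).PosSemidef
  le_klDiv : ∀ x a, ∀ γ' ∈ M.Γ, ENNReal.ofReal (sqNorm (Δ x a) (γ - γ')) ≤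
    InformationTheory.klDiv (M.obsLaw γ (x, a)) (M.obsLaw γ' (x, a))
  subgaussian : ∀ x a, ∀ γ' ∈ M.Γ, HasSubgaussianMGF
    (fun o => logRatio M γ γ' x a o - ∫ o', logRatio M γ γ' x a o' ∂(M.obsLaw γ (x, a)))
    (Cσ * (sqNorm (Δ x a) (γ - γ')).toNNReal) (M.obsLaw γ (x, a))
  concave : ∀ x a o, ConcaveOn ℝ M.Γ (logLik M x a o)
  differentiable : ∀ x a o, DifferentiableOn ℝ (logLik M x a o) M.Γ
  twice_differentiable : ∀ x a o,
    DifferentiableOn ℝ (fderivWithin ℝ (logLik M x a o) M.Γ) M.Γ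
  hessian_le : ∀ x a o, ∀ γ' ∈ M.Γ,
    ‖fderivWithin ℝ (fderivWithin ℝ (logLik M x a o) M.Γ) M.Γ γ'‖ ≤ CΓ

/-- Assumptions on the reward gaps, in environment `γ` and for histories generated by `tf`. -/
structure RewardGaps (M : Model d X A O) (γ : Param d) (astar : Param d → X → A)
    (algStar tf : Policy X A O) (T : ℕ) (ΔExploit Cr : ℝ) : Prop where
  exploit : ∀ n < T, ∀ᵐ h ∂(M.historyLaw γ tf n),
    ∫ a, M.meanReward γ h.2 a ∂(algStar n h) - ∫ a, M.meanReward γ h.2 a ∂(tf n h) ≤ ΔExploit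
  posterior_gap : ∀ n < T, ∀ᵐ h ∂(M.historyLaw γ tf n),
    M.meanReward γ h.2 (astar γ h.2) - ∫ a, M.meanReward γ h.2 a ∂(algStar n h) ≤
      Cr * ∫ γ', ‖γ - γ'‖ ^ 2 ∂(M.posterior h)

end

end SeqDecision

/-! Conditionally on a history, the exploitation gap replaces the played action by the Bayes-optimal
one, and the second gap assumption bounds the rest by `Cr` times the posterior second moment of the
distance to `γ`. Rounds with `lam ≤ 0` cost at most `rbar` each and number `tZero - 1`. What remains
is posterior contraction after `n` rounds when `l = lam Δ ω n > 0`.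

Let `G w` be the log-likelihood of `w` relative to `γ` (`relLogLik`). Each observation contributes a
factor of conditional mean at most one to two products. One dominates `exp (G w / Cσ + l‖w - γ‖² /
(2 Cσ))`, by sub-Gaussianity and the lower bound on the KL divergence
(`lintegral_exp_upper_le_one`). The other is `exp (-G w / Cσ)` times a penalty quadratic in `‖w -
γ‖`, by the matching upper bound on the KL divergence, which comes from concavity and the Hessian
bound (`klMean_le`, `lintegral_exp_lower_le_one`). Both are averaged over the prior, the second one
on a copy of `Γ` shrunk towards `γ` by `1 / R`, where the penalty is bounded. By Markov's inequality
both averages are at most `2T` outside an event of probability `1 / T` (`measure_badEvent_le`). No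
finite cover of `Γ` is needed.

Concavity turns averages into pointwise bounds. For `w` far from `γ`, the midpoints of `w` and the
shrunk copy form a homothetic copy of `Γ` of relative volume `(2R)⁻ᵈ`, on which `G` is at least half
of `G w` plus half of its value at the shrunk point; hence `logLikelihood_le`. Jensen's inequality
on the shrunk copy bounds the evidence from below (`evidence_ge`). Together they give second moment
at most `16 / l * tailExponent` (`secondMoment_le`). The quantities `epsT` and `coverT` enter only
afterwards, in the comparison `tailExponent_le_momentBound`. On the bad events the moment is at most
`4 γbar²`, and `T` rounds of probability `1 / T` sum to the last term of the bound. -/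

namespace SeqDecision

/-! ### Concave functions with Lipschitz gradient -/

section Concave

variable {E : Type*} [NormedAddCommGroup E] [NormedSpace ℝ E]

/-- Restriction to the segment from `x` to `y` reduces this to the slope inequality in one variable.
Derivatives within `s` are used because the true parameter may lie on the boundary of `Γ`. -/
theorem _root_.ConcaveOn.le_add_of_hasFDerivWithinAt {s : Set E} {f : E → ℝ} {f' : E →L[ℝ] ℝ}
    {x y : E} (hf : ConcaveOn ℝ s f) (hx : x ∈ s) (hy : y ∈ s)
    (h : HasFDerivWithinAt f f' s x) : f y ≤ f x + f' (y - x) := by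
  have hline : HasDerivWithinAt (fun t : ℝ => x + t • (y - x)) (y - x) (Set.Icc 0 1) 0 := by
    simpa using (((hasDerivAt_id (0 : ℝ)).smul_const (y - x)).const_add x).hasDerivWithinAt
  have hmaps : Set.MapsTo (fun t : ℝ => x + t • (y - x)) (Set.Icc 0 1) s := fun t ht =>
    hf.1.add_smul_sub_mem hx hy ht
  have hg : HasDerivWithinAt (fun t : ℝ => f (x + t • (y - x))) (f' (y - x)) (Set.Icc 0 1) 0 := by
    have h' : HasFDerivWithinAt f f' s (x + (0 : ℝ) • (y - x)) := by simpa using h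
    exact h'.comp_hasDerivWithinAt (0 : ℝ) hline hmaps
  have hconc : ConcaveOn ℝ (Set.Icc (0 : ℝ) 1) (fun t : ℝ => f (x + t • (y - x))) := by
    have hc := hf.comp_affineMap (AffineMap.lineMap x y : ℝ →ᵃ[ℝ] E)
    have hc' := hc.subset (s := Set.Icc (0 : ℝ) 1) (fun t ht => by
      have := hmaps ht
      simpa [AffineMap.lineMap_apply, add_comm] using this) (convex_Icc 0 1)
    refine hc'.congr (fun t _ => ?_)
    simp [AffineMap.lineMap_apply, add_comm]
  have := ConcaveOn.slope_le_of_hasDerivWithinAt hconc (x := 0) (y := 1) (by simp) (by simp)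
    zero_lt_one hg
  simp only [slope_def_field, zero_smul, one_smul, add_zero, add_sub_cancel, sub_zero,
    div_one] at this
  linarith

/-- A concave function with `C`-Lipschitz gradient lies above its chords, up to a quadratic
error, when extrapolated from a point of the chord. -/
theorem concave_segment_le {s : Set E} {f : E → ℝ} {C : ℝ} (hf : ConcaveOn ℝ s f)
    (hd : DifferentiableOn ℝ f s) (hd2 : DifferentiableOn ℝ (fderivWithin ℝ f s) s)
    (hC : ∀ z ∈ s, ‖fderivWithin ℝ (fderivWithin ℝ f s) s z‖ ≤ C)
    {x y : E} (hx : x ∈ s) (hy : y ∈ s) {t : ℝ} (ht0 : 0 ≤ t) (ht1 : t ≤ 1) :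
    f (x + t • (y - x)) - f x ≤ t * (f y - f x + C * ‖y - x‖ ^ 2) := by
  have hz : x + t • (y - x) ∈ s := hf.1.add_smul_sub_mem hx hy ⟨ht0, ht1⟩
  have h1 := hf.le_add_of_hasFDerivWithinAt hx hz (hd x hx).hasFDerivWithinAt
  -- The tangent at `y` bounds the slope at `y` by the chord; the Lipschitz gradient carries this
  -- bound to `x` at the cost `C * ‖y - x‖ ^ 2`.
  have h2 := hf.le_add_of_hasFDerivWithinAt hy hx (hd y hy).hasFDerivWithinAt
  have h3 := hf.1.norm_image_sub_le_of_norm_fderivWithin_le hd2 hC hx hy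
  have h4 : |(fderivWithin ℝ f s y - fderivWithin ℝ f s x) (y - x)| ≤ C * ‖y - x‖ ^ 2 := by
    refine ((fderivWithin ℝ f s y - fderivWithin ℝ f s x).le_opNorm (y - x)).trans ?_
    calc _ ≤ C * ‖y - x‖ * ‖y - x‖ := by gcongr
      _ = _ := by ring
  have h5 := (abs_le.1 h4).1
  have h6 : fderivWithin ℝ f s y (x - y) = - fderivWithin ℝ f s y (y - x) := by
    rw [← map_neg, neg_sub]
  simp only [add_sub_cancel_left, map_smul, smul_eq_mul] at h1
  simp only [sub_apply] at h5
  have h7 : fderivWithin ℝ f s x (y - x) ≤ f y - f x + C * ‖y - x‖ ^ 2 := by linarith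
  nlinarith [mul_le_mul_of_nonneg_left h7 ht0]

end Concave

/-! ### Minimum eigenvalue and quadratic forms -/

section MinEigenvalue

variable {d : ℕ}

theorem sqNorm_add (D D' : Matrix (Fin d) (Fin d) ℝ) (v : Param d) :
    sqNorm (D + D') v = sqNorm D v + sqNorm D' v := by
  simp [sqNorm, Matrix.add_mulVec]

theorem sqNorm_zero (v : Param d) : sqNorm (0 : Matrix (Fin d) (Fin d) ℝ) v = 0 := by
  simp [sqNorm]

theorem sqNorm_sum {ι : Type*} (s : Finset ι) (D : ι → Matrix (Fin d) (Fin d) ℝ) (v : Param d) :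
    sqNorm (∑ i ∈ s, D i) v = ∑ i ∈ s, sqNorm (D i) v := by
  classical
  induction s using Finset.induction_on with
  | empty => simp [sqNorm_zero]
  | insert a s ha ih => rw [Finset.sum_insert ha, Finset.sum_insert ha, sqNorm_add, ih]

theorem sqNorm_nonneg {D : Matrix (Fin d) (Fin d) ℝ} (hD : D.PosSemidef) (v : Param d) :
    0 ≤ sqNorm D v := by
  simpa [sqNorm] using hD.dotProduct_mulVec_nonneg v.ofLp

theorem sqNorm_eq_sum (D : Matrix (Fin d) (Fin d) ℝ) (v : Param d) :
    sqNorm D v = ∑ i, ∑ j, v.ofLp i * D i j * v.ofLp j := by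
  simp [sqNorm, dotProduct, Matrix.mulVec, Finset.mul_sum, mul_assoc]

theorem sqNorm_eq_inner (D : Matrix (Fin d) (Fin d) ℝ) (v : Param d) :
    sqNorm D v = inner ℝ v (WithLp.toLp 2 (D.mulVec v.ofLp)) := by
  simp [sqNorm, EuclideanSpace.inner_eq_star_dotProduct, dotProduct_comm]

theorem sqNorm_eq_sum_eigenvalues {D : Matrix (Fin d) (Fin d) ℝ} (hD : D.IsHermitian)
    (v : Param d) :
    sqNorm D v = ∑ i, hD.eigenvalues i * (inner ℝ v (hD.eigenvectorBasis i)) ^ 2 := by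
  rw [sqNorm_eq_inner, ← hD.eigenvectorBasis.sum_inner_mul_inner]
  refine Finset.sum_congr rfl fun i _ => ?_
  have hsym : inner ℝ (hD.eigenvectorBasis i) (WithLp.toLp 2 (D.mulVec v.ofLp)) =
      hD.eigenvalues i * inner ℝ v (hD.eigenvectorBasis i) := by
    have h1 := hD.mulVec_eigenvectorBasis i
    have h2 : D.transpose = D := by
      have := hD.eq
      rwa [Matrix.conjTranspose_eq_transpose_of_trivial] at this
    rw [real_inner_comm, EuclideanSpace.inner_eq_star_dotProduct,
      EuclideanSpace.inner_eq_star_dotProduct]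
    simp only [star_trivial]
    rw [Matrix.dotProduct_mulVec, ← Matrix.mulVec_transpose, h2, h1]
    simp
  rw [hsym]; ring

/-- Expansion in an eigenbasis. For `d = 0` the spectrum is empty and its `sInf` carries no
information, hence `hd`. -/
theorem le_minEigenvalue_iff (hd : 0 < d) {D : Matrix (Fin d) (Fin d) ℝ} (hD : D.IsHermitian)
    (c : ℝ) : c ≤ minEigenvalue D ↔ ∀ v : Param d, c * ‖v‖ ^ 2 ≤ sqNorm D v := by
  have : Nonempty (Fin d) := ⟨⟨0, hd⟩⟩
  rw [minEigenvalue, hD.spectrum_real_eq_range_eigenvalues,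
    le_csInf_iff (Set.finite_range _).bddBelow (Set.range_nonempty _)]
  constructor
  · intro h v
    rw [sqNorm_eq_sum_eigenvalues hD, ← hD.eigenvectorBasis.sum_sq_inner_right v, Finset.mul_sum]
    refine Finset.sum_le_sum fun i _ => ?_
    rw [real_inner_comm]
    exact mul_le_mul_of_nonneg_right (h _ ⟨i, rfl⟩) (sq_nonneg _)
  · rintro h _ ⟨i, rfl⟩
    have := h (hD.eigenvectorBasis i)
    rw [sqNorm_eq_sum_eigenvalues hD, Finset.sum_eq_single i] at this
    · simpa using this
    · intro j _ hj
      rw [hD.eigenvectorBasis.orthonormal.2 hj.symm]; simp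
    · simp

theorem minEigenvalue_mul_le (hd : 0 < d) {D : Matrix (Fin d) (Fin d) ℝ} (hD : D.IsHermitian)
    (v : Param d) : minEigenvalue D * ‖v‖ ^ 2 ≤ sqNorm D v :=
  (le_minEigenvalue_iff hd hD _).1 le_rfl v

theorem continuous_sqNorm (D : Matrix (Fin d) (Fin d) ℝ) : Continuous (sqNorm D) := by
  have : sqNorm D = fun v : Param d => ∑ i, ∑ j, v.ofLp i * D i j * v.ofLp j :=
    funext (sqNorm_eq_sum D)
  rw [this]
  fun_prop

/-- Superlevel sets are cut out by the Rayleigh inequalities, and by continuity countably many test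
vectors suffice. -/
theorem measurable_minEigenvalue (hd : 0 < d) {Ω : Type*} [MeasurableSpace Ω]
    {D : Ω → Matrix (Fin d) (Fin d) ℝ} (hD : ∀ ω, (D ω).IsHermitian)
    (hm : ∀ i j, Measurable fun ω => D ω i j) : Measurable fun ω => minEigenvalue (D ω) := by
  refine measurable_of_Ici fun c => ?_
  have : (fun ω => minEigenvalue (D ω)) ⁻¹' Set.Ici c =
      ⋂ n, {ω | c * ‖TopologicalSpace.denseSeq (Param d) n‖ ^ 2 ≤
        sqNorm (D ω) (TopologicalSpace.denseSeq (Param d) n)} := by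
    ext ω
    simp only [Set.mem_preimage, Set.mem_Ici, le_minEigenvalue_iff hd (hD ω), Set.mem_iInter,
      Set.mem_ofPred_eq]
    refine ⟨fun h n => h _, fun h v => ?_⟩
    have hcl : IsClosed {v : Param d | c * ‖v‖ ^ 2 ≤ sqNorm (D ω) v} :=
      isClosed_le (by fun_prop) (continuous_sqNorm _)
    have hsub : Set.range (TopologicalSpace.denseSeq (Param d)) ⊆
        {v : Param d | c * ‖v‖ ^ 2 ≤ sqNorm (D ω) v} := by
      rintro _ ⟨n, rfl⟩; exact h n
    have := hcl.closure_subset_iff.2 hsub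
    exact this ((TopologicalSpace.denseRange_denseSeq (Param d)).closure_range ▸ Set.mem_univ v)
  rw [this]
  refine MeasurableSet.iInter fun n => measurableSet_le measurable_const ?_
  simp_rw [sqNorm_eq_sum]
  exact Finset.measurable_sum _ fun i _ => Finset.measurable_sum _ fun j _ =>
    ((hm i j).const_mul _).mul_const _

end MinEigenvalue

/-! ### Comparison of the tail exponent with `epsT` and `coverT` -/

section Covering

variable {d n : ℕ} {γbar CΓ l : ℝ}

/-- The radius ratio whose `d`-th power is `coverT`. -/
noncomputable def coverScale (d : ℕ) (γbar CΓ : ℝ) (t : ℕ) (l : ℝ) : ℝ :=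
  32 * γbar * √(d : ℝ) * (CΓ * ((t : ℝ) - 1) + l) / (l * min (√(epsT d γbar CΓ t l)) 1)

theorem coverRatio_succ (d n : ℕ) (γbar CΓ l : ℝ) :
    coverRatio d γbar CΓ (n + 1) l = 32 * γbar * √(d : ℝ) * (CΓ * n + l) / l := by
  simp [coverRatio]

theorem two_le_coverRatio (h1 : 1 ≤ 32 * γbar * √(d : ℝ)) (hl : 0 < l) (hlC : l ≤ CΓ * n) :
    2 ≤ coverRatio d γbar CΓ (n + 1) l := by
  rw [coverRatio_succ, le_div_iff₀ hl]
  nlinarith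

theorem log_coverRatio_ge (h1 : 1 ≤ 32 * γbar * √(d : ℝ)) (hl : 0 < l) (hlC : l ≤ CΓ * n) :
    Real.log 2 ≤ Real.log (coverRatio d γbar CΓ (n + 1) l) :=
  Real.log_le_log (by norm_num) (two_le_coverRatio h1 hl hlC)

theorem epsT_pos (hd : 0 < d) (h1 : 1 ≤ 32 * γbar * √(d : ℝ)) (hl : 0 < l) (hlC : l ≤ CΓ * n) :
    0 < epsT d γbar CΓ (n + 1) l := by
  have := log_coverRatio_ge h1 hl hlC
  have h2 := Real.log_two_gt_d9
  have : 0 < Real.log (coverRatio d γbar CΓ (n + 1) l) := by linarith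
  have hd' : (0 : ℝ) < d := by exact_mod_cast hd
  unfold epsT
  positivity

theorem coverScale_eq (d n : ℕ) (γbar CΓ l : ℝ) :
    coverScale d γbar CΓ (n + 1) l =
      coverRatio d γbar CΓ (n + 1) l / min (√(epsT d γbar CΓ (n + 1) l)) 1 := by
  rw [coverScale, coverRatio, div_div]

theorem min_sqrt_epsT_pos (hd : 0 < d) (h1 : 1 ≤ 32 * γbar * √(d : ℝ)) (hl : 0 < l)
    (hlC : l ≤ CΓ * n) : 0 < min (√(epsT d γbar CΓ (n + 1) l)) 1 :=
  lt_min (Real.sqrt_pos.2 (epsT_pos hd h1 hl hlC)) one_pos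

theorem coverRatio_le_coverScale (hd : 0 < d) (h1 : 1 ≤ 32 * γbar * √(d : ℝ)) (hl : 0 < l)
    (hlC : l ≤ CΓ * n) :
    coverRatio d γbar CΓ (n + 1) l ≤ coverScale d γbar CΓ (n + 1) l := by
  have h2 := two_le_coverRatio h1 hl hlC
  rw [coverScale_eq, le_div_iff₀ (min_sqrt_epsT_pos hd h1 hl hlC)]
  exact mul_le_of_le_one_right (by linarith) (min_le_right _ _)

theorem two_le_coverScale (hd : 0 < d) (h1 : 1 ≤ 32 * γbar * √(d : ℝ)) (hl : 0 < l)
    (hlC : l ≤ CΓ * n) : 2 ≤ coverScale d γbar CΓ (n + 1) l :=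
  (two_le_coverRatio h1 hl hlC).trans (coverRatio_le_coverScale hd h1 hl hlC)

theorem log_coverT (hd : 0 < d) (h1 : 1 ≤ 32 * γbar * √(d : ℝ)) (hl : 0 < l)
    (hlC : l ≤ CΓ * n) : Real.log (coverT d γbar CΓ (n + 1) l) =
      d * Real.log (coverScale d γbar CΓ (n + 1) l) := by
  have h2 := two_le_coverScale hd h1 hl hlC
  have : coverT d γbar CΓ (n + 1) l = coverScale d γbar CΓ (n + 1) l ^ d := by
    unfold coverT
    exact max_eq_right (one_le_pow₀ (by unfold coverScale at h2; linarith))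
  rw [this, Real.log_pow]

/-- With `x` the ratio, `k` the scale and `e = epsT`, one has `x² ≤ k² e`. The factor `(CΓ n + l)²`
in `x²` is at least `4 CΓ n l`, so `l` cancels, and the logarithm left over from `e` is at most `x ≤
k`; hence the cube. -/
theorem sq_scale_le (hd : 0 < d) (h1 : 1 ≤ 32 * γbar * √(d : ℝ)) (hl : 0 < l)
    (hlC : l ≤ CΓ * n) :
    256 * (γbar ^ 2 * (CΓ * n)) ≤ coverScale d γbar CΓ (n + 1) l ^ 3 := by
  have hx := two_le_coverRatio h1 hl hlC
  have hxk := coverRatio_le_coverScale hd h1 hl hlC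
  have hL := log_coverRatio_ge h1 hl hlC
  have hL2 := Real.log_two_gt_d9
  have heps := epsT_pos hd h1 hl hlC
  have hmin := min_sqrt_epsT_pos hd h1 hl hlC
  have hLx : Real.log (coverRatio d γbar CΓ (n + 1) l) ≤ coverRatio d γbar CΓ (n + 1) l := by
    have := Real.log_le_sub_one_of_pos (x := coverRatio d γbar CΓ (n + 1) l) (by linarith)
    linarith
  have hk := coverScale_eq d n γbar CΓ l
  set x := coverRatio d γbar CΓ (n + 1) l with hxdef
  set k := coverScale d γbar CΓ (n + 1) l
  set e := epsT d γbar CΓ (n + 1) l with hedef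
  set L := Real.log x
  have hLpos : 0 < L := by linarith
  have hd' : (0 : ℝ) < d := by exact_mod_cast hd
  have h3 : k * √e ≥ x := by
    rw [hk, div_mul_eq_mul_div, ge_iff_le, le_div_iff₀ hmin]
    exact mul_le_mul_of_nonneg_left (min_le_left _ _) (by linarith)
  have h4 : x ^ 2 ≤ k ^ 2 * e := by
    have := pow_le_pow_left₀ (by linarith) h3 2
    rwa [mul_pow, Real.sq_sqrt heps.le] at this
  have h5 : e = 16 * d / l * L := rfl
  have h6 : x = 32 * γbar * √(d : ℝ) * (CΓ * n + l) / l := coverRatio_succ _ _ _ _ _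
  have h7 : x ^ 2 = 1024 * γbar ^ 2 * d * (CΓ * n + l) ^ 2 / l ^ 2 := by
    rw [h6, div_pow, mul_pow, mul_pow, mul_pow, Real.sq_sqrt hd'.le]; norm_num
  have h8 : 4 * (CΓ * n * l) ≤ (CΓ * n + l) ^ 2 := by nlinarith [sq_nonneg (CΓ * n - l)]
  rw [h5, h7, div_le_iff₀ (by positivity)] at h4
  have h9 : 1024 * γbar ^ 2 * d * (4 * (CΓ * n * l)) ≤ k ^ 2 * (16 * d / l * L) * l ^ 2 :=
    (mul_le_mul_of_nonneg_left h8 (by positivity)).trans h4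
  have h10 : k ^ 2 * (16 * d / l * L) * l ^ 2 = (16 * d * l) * (k ^ 2 * L) := by
    field_simp
  have h11 : (16 * d * l) * (256 * (γbar ^ 2 * (CΓ * n))) ≤ (16 * d * l) * (k ^ 2 * L) := by
    rw [← h10]; refine le_trans (le_of_eq ?_) h9; ring
  have h12 := le_of_mul_le_mul_left h11 (by positivity)
  have h13 : k ^ 2 * L ≤ k ^ 2 * k := mul_le_mul_of_nonneg_left (hLx.trans hxk) (by positivity)
  nlinarith

/-- The inverse of the contraction factor with which the parameter set is shrunk. -/
noncomputable def invRadius (γbar C : ℝ) : ℝ := max 1 (4 * (γbar * √C))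

theorem one_le_invRadius (γbar C : ℝ) : 1 ≤ invRadius γbar C := le_max_left _ _

/-- This lets the volume lost by shrinking `Γ` be paid for by `log coverT`. -/
theorem two_log_invRadius_le (hd : 0 < d) (h1 : 1 ≤ 32 * γbar * √(d : ℝ)) (hl : 0 < l)
    (hlC : l ≤ CΓ * n) :
    2 * Real.log (2 * invRadius γbar (CΓ * n)) ≤
      3 * Real.log (coverScale d γbar CΓ (n + 1) l) := by
  have h2 := two_le_coverScale hd h1 hl hlC
  have h3 := sq_scale_le hd h1 hl hlC
  have h4 := one_le_invRadius γbar (CΓ * n)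
  have h5 : (2 * invRadius γbar (CΓ * n)) ^ 2 ≤ coverScale d γbar CΓ (n + 1) l ^ 3 := by
    rcases max_choice 1 (4 * (γbar * √(CΓ * n))) with h | h
    · rw [invRadius, h]
      have := pow_le_pow_left₀ (by norm_num) h2 3
      linarith
    · rw [invRadius, h]
      have h6 : (2 * (4 * (γbar * √(CΓ * n)))) ^ 2 = 64 * (γbar ^ 2 * (CΓ * n)) := by
        rw [mul_pow, mul_pow, mul_pow, Real.sq_sqrt (by linarith)]; ring
      have : 0 ≤ γbar ^ 2 * (CΓ * n) := mul_nonneg (sq_nonneg _) (by linarith)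
      linarith
  have := Real.log_le_log (by positivity) h5
  rwa [Real.log_pow, Real.log_pow] at this

/-- The per-round bound on the posterior second moment. -/
noncomputable def momentBound (d T : ℕ) (γbar CΓ Cσ : ℝ) (t : ℕ) (l : ℝ) : ℝ :=
  epsT d γbar CΓ t l + 16 * (4 * Cσ + 1) * (Real.log (2 * coverT d γbar CΓ t l * T) / l)

theorem momentBound_eq (hd : 0 < d) {T : ℕ} (hT : 1 ≤ T) (Cσ : ℝ)
    (h1 : 1 ≤ 32 * γbar * √(d : ℝ)) (hl : 0 < l) (hlC : l ≤ CΓ * n) :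
    momentBound d T γbar CΓ Cσ (n + 1) l = 16 / l *
      (d * Real.log (coverRatio d γbar CΓ (n + 1) l) + (4 * Cσ + 1) *
        (d * Real.log (coverScale d γbar CΓ (n + 1) l) + Real.log (2 * T))) := by
  have hT' : (0 : ℝ) < T := by exact_mod_cast hT
  have hK : (0 : ℝ) < coverT d γbar CΓ (n + 1) l := lt_of_lt_of_le one_pos (le_max_left _ _)
  rw [momentBound, mul_right_comm 2, mul_comm (2 * (T : ℝ)), Real.log_mul hK.ne' (by positivity),
    log_coverT hd h1 hl hlC, epsT]
  ring

/-- The exponent that governs the posterior tails. -/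
noncomputable def tailExponent (d T : ℕ) (γbar C Cσ : ℝ) : ℝ :=
  2 * Cσ * (d * Real.log (2 * invRadius γbar C)) + d * Real.log (invRadius γbar C) +
    4 * Cσ * Real.log (2 * T) + 3 / 4

theorem one_le_tailExponent {T : ℕ} (hT : 1 ≤ T) {Cσ : ℝ} (hC : 2 ≤ Cσ) (γbar C : ℝ) :
    1 ≤ tailExponent d T γbar C Cσ := by
  have h4 := one_le_invRadius γbar C
  have hT' : (1 : ℝ) ≤ T := by exact_mod_cast hT
  have h5 : Real.log 2 ≤ Real.log (2 * T) := Real.log_le_log (by norm_num) (by linarith)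
  have h6 := Real.log_two_gt_d9
  have h7 : 0 ≤ Real.log (invRadius γbar C) := Real.log_nonneg h4
  have h8 : 0 ≤ Real.log (2 * invRadius γbar C) := Real.log_nonneg (by linarith)
  have h9 : 0 ≤ 2 * Cσ * (d * Real.log (2 * invRadius γbar C)) := by positivity
  have h10 : 0 ≤ d * Real.log (invRadius γbar C) := by positivity
  unfold tailExponent
  nlinarith

theorem tailExponent_le_momentBound (hd : 0 < d) {T : ℕ} (hT : 1 ≤ T) {Cσ : ℝ} (hC : 2 ≤ Cσ)
    (h1 : 1 ≤ 32 * γbar * √(d : ℝ)) (hl : 0 < l) (hlC : l ≤ CΓ * n) :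
    16 / l * tailExponent d T γbar (CΓ * n) Cσ ≤ momentBound d T γbar CΓ Cσ (n + 1) l := by
  rw [momentBound_eq hd hT Cσ h1 hl hlC]
  refine mul_le_mul_of_nonneg_left ?_ (by positivity)
  have hT' : (1 : ℝ) ≤ T := by exact_mod_cast hT
  have h5 : Real.log 2 ≤ Real.log (2 * T) := Real.log_le_log (by norm_num) (by linarith)
  have h6 := Real.log_two_gt_d9
  have h4 := one_le_invRadius γbar (CΓ * n)
  have hL := log_coverRatio_ge h1 hl hlC
  have hk : Real.log 2 ≤ Real.log (coverScale d γbar CΓ (n + 1) l) :=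
    Real.log_le_log (by norm_num) (two_le_coverScale hd h1 hl hlC)
  have hr := two_log_invRadius_le hd h1 hl hlC
  have hsplit : Real.log (2 * invRadius γbar (CΓ * n)) =
      Real.log 2 + Real.log (invRadius γbar (CΓ * n)) :=
    Real.log_mul (by norm_num) (by positivity)
  have hd' : (1 : ℝ) ≤ d := by exact_mod_cast hd
  unfold tailExponent
  rw [hsplit] at hr ⊢
  set L := Real.log (coverRatio d γbar CΓ (n + 1) l)
  set k := Real.log (coverScale d γbar CΓ (n + 1) l)
  set r := Real.log (invRadius γbar (CΓ * n))
  -- The volume terms use `3 Cσ d k + (3 / 2) d k` of the available `(4 Cσ + 1) d k`; this fits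
  -- because `Cσ ≥ 2`, and the slack absorbs `3 / 4`.
  have e1 : 2 * Cσ * (d * (Real.log 2 + r)) ≤ 3 * Cσ * (d * k) := by
    have : 0 ≤ Cσ * d := by positivity
    nlinarith [mul_le_mul_of_nonneg_left hr this]
  have e2 : d * r ≤ d * (3 / 2 * k) - d * Real.log 2 := by nlinarith
  have e3 : 2 * (d * k) ≤ Cσ * (d * k) := mul_le_mul_of_nonneg_right hC (by nlinarith)
  have e4 : Real.log 2 ≤ d * k := by nlinarith
  have e5 : Real.log 2 ≤ d * L := by nlinarith
  have e6 : Real.log 2 ≤ d * Real.log 2 := by nlinarith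
  nlinarith

/-- For `l ≥ 1` the minimum in the denominator is at least `1 / √l`, because `16 d log 2 ≥ 1`. The
scale is then polynomial in `d` and `T`, with no dependence on `l`. -/
theorem log_coverScale_le (hd : 0 < d) {T : ℕ} (hCΓ : 0 < CΓ)
    (h1 : 1 ≤ 32 * γbar * √(d : ℝ)) (hl : 1 ≤ l) (hlC : l ≤ CΓ * n) (hn : n ≤ T) :
    Real.log (coverScale d γbar CΓ (n + 1) l) ≤
      |Real.log (64 * γbar * CΓ)| + Real.log (2 * d * T) := by
  have hl0 : 0 < l := by linarith
  have hd' : (1 : ℝ) ≤ d := by exact_mod_cast hd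
  have hx := two_le_coverRatio h1 hl0 hlC
  have hL := log_coverRatio_ge h1 hl0 hlC
  have hL2 := Real.log_two_gt_d9
  have hmin := min_sqrt_epsT_pos hd h1 hl0 hlC
  have hnT : (n : ℝ) ≤ T := by exact_mod_cast hn
  have hγ : 0 < γbar := by
    by_contra h
    have := mul_nonpos_of_nonpos_of_nonneg (not_lt.1 h) (Real.sqrt_nonneg (d : ℝ))
    linarith
  have hn0 : (0 : ℝ) < n := by
    by_contra h
    have := mul_nonpos_of_nonneg_of_nonpos hCΓ.le (not_lt.1 h)
    linarith
  have hsl : 1 ≤ √l := Real.one_le_sqrt.2 hl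
  have hinv : (√l)⁻¹ ≤ min (√(epsT d γbar CΓ (n + 1) l)) 1 := by
    refine le_min ?_ (inv_le_one_of_one_le₀ hsl)
    rw [← Real.sqrt_inv]
    refine Real.sqrt_le_sqrt ?_
    unfold epsT
    rw [div_mul_eq_mul_div, inv_eq_one_div]
    gcongr
    nlinarith
  have h3 : coverScale d γbar CΓ (n + 1) l ≤ 64 * γbar * CΓ * (2 * d * T) := by
    have hsd : √(d : ℝ) ≤ d := by
      rw [Real.sqrt_le_left (by linarith)]; nlinarith
    calc coverScale d γbar CΓ (n + 1) l
        ≤ coverRatio d γbar CΓ (n + 1) l / (√l)⁻¹ := by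
          rw [coverScale_eq]
          exact div_le_div_of_nonneg_left (by linarith) (by positivity) hinv
      _ = 32 * γbar * √(d : ℝ) * (CΓ * n + l) * (√l / l) := by
          rw [coverRatio_succ, div_inv_eq_mul]; ring
      _ ≤ 32 * γbar * d * (CΓ * T + CΓ * T) * 1 := by
          have h7 : √l / l ≤ 1 := by
            rw [div_le_one hl0, Real.sqrt_le_left hl0.le]; nlinarith
          have h8 : CΓ * n ≤ CΓ * T := mul_le_mul_of_nonneg_left hnT hCΓ.le
          have h9 : l ≤ CΓ * T := hlC.trans h8
          gcongr
      _ ≤ 64 * γbar * CΓ * (2 * d * T) := by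
          have : 0 ≤ 64 * γbar * CΓ * (d * T) := by positivity
          nlinarith
  have hT0 : (0 : ℝ) < T := by linarith
  have h4 := Real.log_le_log (by linarith [two_le_coverScale hd h1 hl0 hlC]) h3
  rw [Real.log_mul (by positivity) (by positivity)] at h4
  linarith [le_abs_self (Real.log (64 * γbar * CΓ))]

theorem momentBound_le (hd : 0 < d) {T : ℕ} (hT : 1 ≤ T) (hCΓ : 0 < CΓ) {Cσ : ℝ} (hC : 0 ≤ Cσ)
    (h1 : 1 ≤ 32 * γbar * √(d : ℝ)) (hl : 1 ≤ l) (hlC : l ≤ CΓ * n) (hn : n ≤ T) :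
    momentBound d T γbar CΓ Cσ (n + 1) l ≤
      16 * ((4 * Cσ + 2) * (|Real.log (64 * γbar * CΓ)| / Real.log 2 + 1) + (4 * Cσ + 1)) *
        Real.log (2 * d * T) * (d / l) := by
  have hl0 : 0 < l := by linarith
  have hd' : (1 : ℝ) ≤ d := by exact_mod_cast hd
  have hT' : (1 : ℝ) ≤ T := by exact_mod_cast hT
  have hL2 := Real.log_two_gt_d9
  have hk := log_coverScale_le hd hCΓ h1 hl hlC hn
  have hxk : Real.log (coverRatio d γbar CΓ (n + 1) l) ≤
      Real.log (coverScale d γbar CΓ (n + 1) l) :=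
    Real.log_le_log (by linarith [two_le_coverRatio h1 hl0 hlC])
      (coverRatio_le_coverScale hd h1 hl0 hlC)
  have hD : Real.log 2 ≤ Real.log (2 * d * T) := Real.log_le_log (by norm_num) (by nlinarith)
  have hDT : Real.log (2 * T) ≤ Real.log (2 * d * T) :=
    Real.log_le_log (by positivity) (by nlinarith)
  have habs : |Real.log (64 * γbar * CΓ)| ≤
      |Real.log (64 * γbar * CΓ)| / Real.log 2 * Real.log (2 * d * T) := by
    rw [div_mul_eq_mul_div, le_div_iff₀ (by linarith)]
    exact mul_le_mul_of_nonneg_left hD (abs_nonneg _)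
  rw [momentBound_eq hd hT Cσ h1 hl0 hlC]
  set L := Real.log (coverRatio d γbar CΓ (n + 1) l)
  set k := Real.log (coverScale d γbar CΓ (n + 1) l)
  set a := |Real.log (64 * γbar * CΓ)| / Real.log 2
  set D := Real.log (2 * d * T)
  have hk' : k ≤ (a + 1) * D := by linarith
  have key : d * L + (4 * Cσ + 1) * (d * k + Real.log (2 * T)) ≤
      ((4 * Cσ + 2) * (a + 1) + (4 * Cσ + 1)) * D * d := by
    have e1 : d * L ≤ d * ((a + 1) * D) := by gcongr; linarith
    have e2 : d * k + Real.log (2 * T) ≤ d * ((a + 1) * D) + d * D := by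
      have : D ≤ d * D := by nlinarith
      gcongr; linarith
    have e3 := mul_le_mul_of_nonneg_left e2 (show 0 ≤ 4 * Cσ + 1 by linarith)
    nlinarith
  calc _ ≤ 16 / l * (((4 * Cσ + 2) * (a + 1) + (4 * Cσ + 1)) * D * d) := by gcongr
    _ = _ := by ring

end Covering

/-! ### Laws of rounds and histories -/

namespace Model

variable {d : ℕ} {X A O : Type*} [MeasurableSpace X] [MeasurableSpace A] [MeasurableSpace O]
  (M : Model d X A O) {γ : Param d}

theorem measurable_uncurry_obsDens (γ : Param d) :
    Measurable (Function.uncurry fun (xa : X × A) (o : O) =>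
      ENNReal.ofReal (M.obsDens γ xa.1 xa.2 o)) :=
  (M.obsDens_measurable.comp (measurable_const.prodMk measurable_id)).ennreal_ofReal

theorem measurable_obsDens (γ : Param d) (x : X) (a : A) : Measurable (M.obsDens γ x a) :=
  M.obsDens_measurable.comp (f := fun o => (γ, ((x, a), o))) (by fun_prop)

theorem obsLaw_apply (γ : Param d) (x : X) (a : A) :
    M.obsLaw γ (x, a) =
      (M.obsRef (x, a)).withDensity (fun o => ENNReal.ofReal (M.obsDens γ x a o)) :=
  Kernel.withDensity_apply _ (M.measurable_uncurry_obsDens γ) _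

theorem isMarkovKernel_obsLaw (hγ : γ ∈ M.Γ) : IsMarkovKernel (M.obsLaw γ) := by
  refine ⟨fun xa => ⟨?_⟩⟩
  obtain ⟨x, a⟩ := xa
  rw [obsLaw_apply, withDensity_apply _ MeasurableSet.univ, Measure.restrict_univ,
    M.obsDens_prob γ hγ]

theorem isProbabilityMeasure_ctxLaw (hγ : γ ∈ M.Γ) : IsProbabilityMeasure (M.ctxLaw γ) := by
  refine ⟨?_⟩
  rw [ctxLaw, withDensity_apply _ MeasurableSet.univ, Measure.restrict_univ, M.ctxDens_prob γ hγ]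

theorem isMarkovKernel_roundKernel (hγ : γ ∈ M.Γ) (f : Policy X A O) (n : ℕ)
    [IsMarkovKernel (f n)] : IsMarkovKernel (M.roundKernel γ f n) := by
  have := M.isMarkovKernel_obsLaw hγ
  have := M.isProbabilityMeasure_ctxLaw hγ
  unfold roundKernel
  infer_instance

theorem measurable_snoc {R : Type*} [MeasurableSpace R] (n : ℕ) :
    Measurable (fun q : (Fin n → R) × R => Fin.snoc (α := fun _ => R) q.1 q.2) := by
  refine measurable_pi_lambda _ fun i => ?_
  refine Fin.lastCases ?_ (fun j => ?_) i
  · simpa using measurable_snd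
  · simp only [Fin.snoc_castSucc]
    fun_prop

variable (f : Policy X A O) [∀ n, IsMarkovKernel (f n)]

theorem isProbabilityMeasure_roundsLaw (hγ : γ ∈ M.Γ) (n : ℕ) :
    IsProbabilityMeasure (M.roundsLaw γ f n) := by
  induction n with
  | zero => rw [roundsLaw]; infer_instance
  | succ n ih =>
    have := M.isMarkovKernel_roundKernel hγ f n
    rw [roundsLaw]
    exact Measure.isProbabilityMeasure_map (measurable_snoc n).aemeasurable

theorem isProbabilityMeasure_historyLaw (hγ : γ ∈ M.Γ) (n : ℕ) :
    IsProbabilityMeasure (M.historyLaw γ f n) := by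
  have := M.isProbabilityMeasure_roundsLaw f hγ n
  have := M.isProbabilityMeasure_ctxLaw hγ
  unfold historyLaw
  infer_instance

theorem lintegral_roundKernel (hγ : γ ∈ M.Γ) (n : ℕ) (ω : Fin n → Round X A O)
    {F : Round X A O → ℝ≥0∞} (hF : Measurable F) :
    ∫⁻ r, F r ∂(M.roundKernel γ f n ω) =
      ∫⁻ x, ∫⁻ a, ∫⁻ o, F ((x, a), o) ∂(M.obsLaw γ (x, a)) ∂(f n (ω, x)) ∂(M.ctxLaw γ) := by
  have := M.isMarkovKernel_obsLaw hγ
  have := M.isProbabilityMeasure_ctxLaw hγ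
  rw [roundKernel, Kernel.lintegral_compProd _ _ _ hF, Kernel.lintegral_compProd]
  · simp [Kernel.comap_apply]
  · simp only [Kernel.comap_apply]
    exact (Measurable.lintegral_kernel_prod_right' (κ := M.obsLaw γ)
      (f := F) hF)

theorem lintegral_roundsLaw_succ (hγ : γ ∈ M.Γ) (n : ℕ)
    {F : (Fin (n + 1) → Round X A O) → ℝ≥0∞} (hF : Measurable F) :
    ∫⁻ ω, F ω ∂(M.roundsLaw γ f (n + 1)) =
      ∫⁻ ω, ∫⁻ r, F (Fin.snoc (α := fun _ => Round X A O) ω r) ∂(M.roundKernel γ f n ω)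
        ∂(M.roundsLaw γ f n) := by
  have := M.isMarkovKernel_roundKernel hγ f n
  have := M.isProbabilityMeasure_roundsLaw f hγ n
  rw [roundsLaw, lintegral_map hF (measurable_snoc n)]
  exact Measure.lintegral_compProd (hF.comp (measurable_snoc n))

/-- A product of factors with conditional mean at most one has mean at most one. -/
theorem lintegral_prod_le_one (hγ : γ ∈ M.Γ) {φ : Round X A O → ℝ≥0∞} (hφ : Measurable φ)
    (h : ∀ x a, ∫⁻ o, φ ((x, a), o) ∂(M.obsLaw γ (x, a)) ≤ 1) (n : ℕ) :
    ∫⁻ ω, ∏ i, φ (ω i) ∂(M.roundsLaw γ f n) ≤ 1 := by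
  induction n with
  | zero => simp [roundsLaw]
  | succ n ih =>
    have hround : ∀ ω, ∫⁻ r, φ r ∂(M.roundKernel γ f n ω) ≤ 1 := fun ω => by
      have := M.isProbabilityMeasure_ctxLaw hγ
      rw [M.lintegral_roundKernel f hγ n ω hφ]
      calc _ ≤ ∫⁻ x, ∫⁻ a, 1 ∂(f n (ω, x)) ∂(M.ctxLaw γ) :=
            lintegral_mono fun x => lintegral_mono fun a => h x a
        _ = 1 := by simp
    have hm : Measurable fun ω : Fin (n + 1) → Round X A O => ∏ i, φ (ω i) := by fun_prop
    rw [M.lintegral_roundsLaw_succ f hγ n hm]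
    refine le_trans (lintegral_mono fun ω => ?_) ih
    -- Supermartingale step: the earlier factors are constant given the past, and the new one
    -- integrates to at most one.
    simp only [Fin.prod_univ_castSucc, Fin.snoc_castSucc, Fin.snoc_last]
    rw [lintegral_const_mul _ hφ]
    exact mul_le_of_le_one_right' (hround ω)

theorem map_init_roundsLaw (hγ : γ ∈ M.Γ) (n : ℕ) :
    (M.roundsLaw γ f (n + 1)).map (fun ω (i : Fin n) => ω i.castSucc) = M.roundsLaw γ f n := by
  have := M.isMarkovKernel_roundKernel hγ f n
  have := M.isProbabilityMeasure_roundsLaw f hγ n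
  rw [roundsLaw, Measure.map_map (by fun_prop) (measurable_snoc n)]
  have : (fun (ω : Fin (n + 1) → Round X A O) (i : Fin n) => ω i.castSucc) ∘
      (fun q : (Fin n → Round X A O) × Round X A O =>
        Fin.snoc (α := fun _ => Round X A O) q.1 q.2) = Prod.fst := by
    ext q i : 2; simp
  rw [this]
  exact Measure.fst_compProd _ _

/-- Consistency of the laws: it moves expectations computed after `n` rounds to the single space of
`T` rounds on which the theorem is stated. -/
theorem map_castLE_roundsLaw (hγ : γ ∈ M.Γ) {n T : ℕ} (h : n ≤ T) :
    (M.roundsLaw γ f T).map (fun ω (i : Fin n) => ω (i.castLE h)) = M.roundsLaw γ f n := by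
  induction T, h using Nat.le_induction with
  | base => exact Measure.map_id
  | succ T hT ih =>
    rw [← ih, ← M.map_init_roundsLaw f hγ T, Measure.map_map (by fun_prop) (by fun_prop)]
    rfl

theorem map_fst_historyLaw (hγ : γ ∈ M.Γ) (n : ℕ) :
    (M.historyLaw γ f n).map Prod.fst = M.roundsLaw γ f n := by
  have := M.isProbabilityMeasure_roundsLaw f hγ n
  have := M.isProbabilityMeasure_ctxLaw hγ
  exact Measure.fst_prod

/-- The law of the context and the action of a round. -/
theorem lintegral_roundsLaw_action (hγ : γ ∈ M.Γ) {n T : ℕ} (h : n < T) {ψ : X × A → ℝ≥0∞}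
    (hψ : Measurable ψ) :
    ∫⁻ ω, ψ (ω ⟨n, h⟩).1 ∂(M.roundsLaw γ f T) =
      ∫⁻ h, ∫⁻ a, ψ (h.2, a) ∂(f n h) ∂(M.historyLaw γ f n) := by
  have := M.isProbabilityMeasure_roundsLaw f hγ n
  have := M.isProbabilityMeasure_ctxLaw hγ
  have := M.isMarkovKernel_obsLaw hγ
  have hF : Measurable fun ω : Fin (n + 1) → Round X A O => ψ (ω (Fin.last n)).1 := by fun_prop
  have h1 : ∫⁻ ω, ψ (ω ⟨n, h⟩).1 ∂(M.roundsLaw γ f T) =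
      ∫⁻ ω, ψ (ω (Fin.last n)).1 ∂(M.roundsLaw γ f (n + 1)) := by
    rw [← M.map_castLE_roundsLaw f hγ (Nat.succ_le_of_lt h), lintegral_map hF (by fun_prop)]
    rfl
  rw [h1, M.lintegral_roundsLaw_succ f hγ n hF, historyLaw, lintegral_prod]
  · refine lintegral_congr fun ω => ?_
    simp only [Fin.snoc_last]
    rw [M.lintegral_roundKernel f hγ n ω (F := fun r => ψ r.1) (by fun_prop)]
    simp
  · exact (Measurable.lintegral_kernel_prod_right' (κ := f n)
      (f := fun q : History X A O n × A => ψ (q.1.2, q.2)) (by fun_prop)).aemeasurable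

end Model

/-! ### Likelihood ratios and the KL divergence -/

namespace Model

variable {d : ℕ} {X A O : Type*} [MeasurableSpace X] [MeasurableSpace A] [MeasurableSpace O]
  (M : Model d X A O) {γ w : Param d}

theorem measurable_logRatio_uncurry (γ : Param d) :
    Measurable fun p : Param d × Round X A O =>
      logRatio M γ p.1 p.2.1.1 p.2.1.2 p.2.2 := by
  have h1 : Measurable fun p : Param d × Round X A O =>
      M.obsDens γ p.2.1.1 p.2.1.2 p.2.2 :=
    M.obsDens_measurable.comp (f := fun p : Param d × Round X A O => (γ, p.2)) (by fun_prop)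
  exact Real.measurable_log.comp (h1.div M.obsDens_measurable)

theorem measurable_logRatio (γ w : Param d) (x : X) (a : A) :
    Measurable (logRatio M γ w x a) :=
  (M.measurable_logRatio_uncurry γ).comp (f := fun o => (w, ((x, a), o))) (by fun_prop)

theorem logRatio_eq (hγ : γ ∈ M.Γ) (hw : w ∈ M.Γ) (x : X) (a : A) (o : O) :
    logRatio M γ w x a o = logLik M x a o γ - logLik M x a o w :=
  Real.log_div (M.obsDens_pos γ hγ x a o).ne' (M.obsDens_pos w hw x a o).ne'

theorem exp_neg_logRatio (hγ : γ ∈ M.Γ) (hw : w ∈ M.Γ) (x : X) (a : A) (o : O) :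
    Real.exp (- logRatio M γ w x a o) = M.obsDens w x a o / M.obsDens γ x a o := by
  rw [logRatio, ← Real.log_inv, inv_div,
    Real.exp_log (div_pos (M.obsDens_pos w hw x a o) (M.obsDens_pos γ hγ x a o))]

/-- Change of measure: the integrand is the density ratio of `w` against `γ`. Both upper bounds on
the KL divergence rest on this identity. -/
theorem lintegral_exp_neg_logRatio (hγ : γ ∈ M.Γ) (hw : w ∈ M.Γ) (x : X) (a : A) :
    ∫⁻ o, ENNReal.ofReal (Real.exp (- logRatio M γ w x a o)) ∂(M.obsLaw γ (x, a)) = 1 := by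
  rw [obsLaw_apply, lintegral_withDensity_eq_lintegral_mul _
    (M.measurable_obsDens γ x a).ennreal_ofReal
    (M.measurable_logRatio γ w x a).fun_neg.exp.ennreal_ofReal, ← M.obsDens_prob w hw x a]
  refine lintegral_congr fun o => ?_
  have h := M.obsDens_pos γ hγ x a o
  rw [Pi.mul_apply, M.exp_neg_logRatio hγ hw, ← ENNReal.ofReal_mul h.le, mul_div_cancel₀ _ h.ne']

theorem obsLaw_eq_withDensity (γ : Param d) (hw : w ∈ M.Γ) (x : X) (a : A) :
    M.obsLaw γ (x, a) = (M.obsLaw w (x, a)).withDensity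
      (fun o => ENNReal.ofReal (M.obsDens γ x a o / M.obsDens w x a o)) := by
  rw [obsLaw_apply, obsLaw_apply, ← withDensity_mul _
    (M.measurable_obsDens w x a).ennreal_ofReal
    ((M.measurable_obsDens γ x a).fun_div (M.measurable_obsDens w x a)).ennreal_ofReal]
  congr 1
  ext o
  have h := M.obsDens_pos w hw x a o
  rw [Pi.mul_apply, ← ENNReal.ofReal_mul h.le, mul_div_cancel₀ _ h.ne']

theorem toReal_klDiv_obsLaw (hγ : γ ∈ M.Γ) (hw : w ∈ M.Γ) (x : X) (a : A)
    (hint : Integrable (logRatio M γ w x a) (M.obsLaw γ (x, a))) :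
    InformationTheory.klDiv (M.obsLaw γ (x, a)) (M.obsLaw w (x, a)) ≠ ∞ ∧
      (InformationTheory.klDiv (M.obsLaw γ (x, a)) (M.obsLaw w (x, a))).toReal =
        ∫ o, logRatio M γ w x a o ∂(M.obsLaw γ (x, a)) := by
  have := M.isMarkovKernel_obsLaw hγ
  have := M.isMarkovKernel_obsLaw hw
  have hac : M.obsLaw γ (x, a) ≪ M.obsLaw w (x, a) := by
    rw [M.obsLaw_eq_withDensity γ hw x a]
    exact withDensity_absolutelyContinuous _ _
  have hrn : llr (M.obsLaw γ (x, a)) (M.obsLaw w (x, a)) =ᵐ[M.obsLaw γ (x, a)]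
      logRatio M γ w x a := by
    have h := Measure.rnDeriv_withDensity (M.obsLaw w (x, a))
      ((M.measurable_obsDens γ x a).div (M.measurable_obsDens w x a)).ennreal_ofReal
    have h2 : (M.obsLaw γ (x, a)).rnDeriv (M.obsLaw w (x, a)) =ᵐ[M.obsLaw w (x, a)]
        fun o => ENNReal.ofReal (M.obsDens γ x a o / M.obsDens w x a o) := by
      have h3 := M.obsLaw_eq_withDensity γ hw x a
      nth_rewrite 1 [h3]
      exact h
    filter_upwards [hac.ae_le h2] with o ho
    rw [llr, ho, ENNReal.toReal_ofReal
      (div_pos (M.obsDens_pos γ hγ x a o) (M.obsDens_pos w hw x a o)).le]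
    rfl
  have hint' : Integrable (llr (M.obsLaw γ (x, a)) (M.obsLaw w (x, a))) (M.obsLaw γ (x, a)) :=
    hint.congr hrn.symm
  exact ⟨InformationTheory.klDiv_ne_top hac hint', by
    rw [InformationTheory.toReal_klDiv_of_measure_eq hac (by simp), integral_congr_ae hrn]⟩

end Model

/-! ### Exponential moment bounds for one observation -/

namespace ObservationModel

variable {d : ℕ} {X A O : Type*} [MeasurableSpace X] [MeasurableSpace A] [MeasurableSpace O]
  {M : Model d X A O} {γ w : Param d} {Δ : X → A → Matrix (Fin d) (Fin d) ℝ} {Cσ : ℝ≥0} {CΓ : ℝ}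

theorem integrable_logRatio (h : ObservationModel M γ Δ Cσ CΓ) (hγ : γ ∈ M.Γ) (hw : w ∈ M.Γ)
    (x : X) (a : A) : Integrable (logRatio M γ w x a) (M.obsLaw γ (x, a)) := by
  have := M.isMarkovKernel_obsLaw hγ
  have h1 := (h.subgaussian x a w hw).integrable
  refine (h1.add (integrable_const (∫ o', logRatio M γ w x a o' ∂(M.obsLaw γ (x, a))))).congr
    (Filter.Eventually.of_forall fun o => ?_)
  simp only [Pi.add_apply, sub_add_cancel]

/-- Convexity is contained in `ConcaveOn`, but an observation is needed to invoke it; one exists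
because the observation law has mass one. -/
theorem convex (h : ObservationModel M γ Δ Cσ CΓ) (hγ : γ ∈ M.Γ) (x : X) (a : A) :
    Convex ℝ M.Γ := by
  have := M.isMarkovKernel_obsLaw hγ
  obtain ⟨o⟩ := nonempty_of_isProbabilityMeasure (M.obsLaw γ (x, a))
  exact (h.concave x a o).1

/-- The conditional mean of the log-likelihood ratio. -/
noncomputable def klMean (M : Model d X A O) (γ w : Param d) (x : X) (a : A) : ℝ :=
  ∫ o, logRatio M γ w x a o ∂(M.obsLaw γ (x, a))

theorem sqNorm_le_klMean (h : ObservationModel M γ Δ Cσ CΓ) (hγ : γ ∈ M.Γ) (hw : w ∈ M.Γ)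
    (x : X) (a : A) : sqNorm (Δ x a) (γ - w) ≤ klMean M γ w x a := by
  obtain ⟨h1, h2⟩ := M.toReal_klDiv_obsLaw hγ hw x a (h.integrable_logRatio hγ hw x a)
  rw [klMean, ← h2]
  exact (ENNReal.ofReal_le_iff_le_toReal h1).1 (h.le_klDiv x a w hw)

theorem lintegral_exp_le (h : ObservationModel M γ Δ Cσ CΓ) (hw : w ∈ M.Γ) (x : X) (a : A)
    (t b : ℝ) :
    ∫⁻ o, ENNReal.ofReal (Real.exp (t * logRatio M γ w x a o + b)) ∂(M.obsLaw γ (x, a)) ≤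
      ENNReal.ofReal (Real.exp (Cσ * sqNorm (Δ x a) (γ - w) * t ^ 2 / 2 +
        (t * klMean M γ w x a + b))) := by
  have h1 := h.subgaussian x a w hw
  have h2 := h1.mgf_le t
  rw [NNReal.coe_mul, Real.coe_toNNReal _ (sqNorm_nonneg (h.posSemidef x a) _), mgf] at h2
  have h3 := ofReal_integral_eq_lintegral_ofReal (h1.integrable_exp_mul t)
    (Filter.Eventually.of_forall fun o => (Real.exp_pos _).le)
  have h4 : ∀ o, ENNReal.ofReal (Real.exp (t * logRatio M γ w x a o + b)) =
      ENNReal.ofReal (Real.exp (t * (logRatio M γ w x a o -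
        ∫ o', logRatio M γ w x a o' ∂(M.obsLaw γ (x, a))))) *
      ENNReal.ofReal (Real.exp (t * klMean M γ w x a + b)) := fun o => by
    rw [← ENNReal.ofReal_mul (Real.exp_pos _).le, ← Real.exp_add, klMean]
    ring_nf
  simp_rw [h4]
  rw [lintegral_mul_const' _ _ ENNReal.ofReal_ne_top, ← h3,
    ← ENNReal.ofReal_mul (integral_nonneg fun o => (Real.exp_pos _).le), Real.exp_add (Cσ * _ * _ / _)]
  exact ENNReal.ofReal_le_ofReal (mul_le_mul_of_nonneg_right h2 (Real.exp_pos _).le)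

theorem klMean_le_subgaussian (h : ObservationModel M γ Δ Cσ CΓ) (hγ : γ ∈ M.Γ) (hw : w ∈ M.Γ)
    (x : X) (a : A) : klMean M γ w x a ≤ Cσ * sqNorm (Δ x a) (γ - w) / 2 := by
  have h1 := h.lintegral_exp_le hw x a (-1) 0
  simp only [neg_mul, one_mul, add_zero, M.lintegral_exp_neg_logRatio hγ hw] at h1
  rw [ENNReal.one_le_ofReal, Real.one_le_exp_iff] at h1
  linarith

/-- The KL divergence lies between `q` and `Cσ q / 2`, where `q` is the squared norm. So the
variance constant cannot be small once some direction is informative, which is what makes the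
constants close up later. -/
theorem two_le_variance (h : ObservationModel M γ Δ Cσ CΓ) (hγ : γ ∈ M.Γ) (hw : w ∈ M.Γ)
    (x : X) (a : A) (hq : 0 < sqNorm (Δ x a) (γ - w)) : (2 : ℝ) ≤ Cσ := by
  have h1 := h.klMean_le_subgaussian hγ hw x a
  have h2 := h.sqNorm_le_klMean hγ hw x a
  by_contra hlt
  nlinarith

/-- Heuristically the score at `γ` has mean zero, so only the Hessian contributes. To avoid
differentiating under the integral, the unit mass identity is applied at the point `γ + t (w - γ)`,
`concave_segment_le` bounds its log-likelihood, and the sub-Gaussian bound leaves an error of order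
`t` after division by `t`. -/
theorem klMean_le (h : ObservationModel M γ Δ Cσ CΓ) (hγ : γ ∈ M.Γ) (hw : w ∈ M.Γ)
    (x : X) (a : A) : klMean M γ w x a ≤ CΓ * ‖w - γ‖ ^ 2 := by
  set q := sqNorm (Δ x a) (γ - w) with hq
  have hq0 : 0 ≤ q := sqNorm_nonneg (h.posSemidef x a) _
  have key : ∀ t : ℝ, 0 < t → t ≤ 1 →
      klMean M γ w x a - CΓ * ‖w - γ‖ ^ 2 ≤ Cσ * q * t / 2 := by
    intro t ht0 ht1
    have hz : γ + t • (w - γ) ∈ M.Γ :=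
      (h.convex hγ x a).add_smul_sub_mem hγ hw ⟨ht0.le, ht1⟩
    have h1 := M.lintegral_exp_neg_logRatio hγ hz x a
    have h2 : (1 : ℝ≥0∞) ≤ ∫⁻ o, ENNReal.ofReal (Real.exp ((-t) * logRatio M γ w x a o +
        t * (CΓ * ‖w - γ‖ ^ 2))) ∂(M.obsLaw γ (x, a)) := by
      rw [← h1]
      refine lintegral_mono fun o => ENNReal.ofReal_le_ofReal (Real.exp_le_exp.2 ?_)
      have h3 := concave_segment_le (h.concave x a o) (h.differentiable x a o)
        (h.twice_differentiable x a o) (h.hessian_le x a o) hγ hw ht0.le ht1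
      rw [M.logRatio_eq hγ hz, M.logRatio_eq hγ hw]
      linarith
    have h4 := h2.trans (h.lintegral_exp_le hw x a (-t) _)
    rw [ENNReal.one_le_ofReal, Real.one_le_exp_iff, ← hq] at h4
    have h5 : 0 ≤ t * (Cσ * q * t / 2 - (klMean M γ w x a - CΓ * ‖w - γ‖ ^ 2)) := by nlinarith
    linarith [nonneg_of_mul_nonneg_right h5 ht0]
  by_contra hlt
  rw [not_le] at hlt
  set e := klMean M γ w x a - CΓ * ‖w - γ‖ ^ 2 with he
  have he0 : 0 < e := by linarith
  have hc : 0 ≤ Cσ * q := by positivity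
  -- This `t` is at most one and makes the error `Cσ q t / 2` at most `e / 2`, contradicting `e >
  -- 0`.
  have hpos : 0 < e / (Cσ * q + e) := by positivity
  have h6 := key _ hpos (by rw [div_le_one (by linarith)]; linarith)
  have h7 : Cσ * q * (e / (Cσ * q + e)) ≤ e := by
    rw [mul_div_assoc', div_le_iff₀ (by linarith)]; nlinarith
  linarith

theorem sqNorm_le (h : ObservationModel M γ Δ Cσ CΓ) (hγ : γ ∈ M.Γ) (hw : w ∈ M.Γ)
    (x : X) (a : A) : sqNorm (Δ x a) (γ - w) ≤ CΓ * ‖w - γ‖ ^ 2 :=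
  (h.sqNorm_le_klMean hγ hw x a).trans (h.klMean_le hγ hw x a)

/-- At the exponent `-1 / Cσ` the variance term is `q / (2 Cσ)` and the mean term at most `-q / Cσ`;
half of the gain is left for the added term. -/
theorem lintegral_exp_upper_le_one (h : ObservationModel M γ Δ Cσ CΓ) (hγ : γ ∈ M.Γ)
    (hw : w ∈ M.Γ) (x : X) (a : A) :
    ∫⁻ o, ENNReal.ofReal (Real.exp ((-(Cσ : ℝ)⁻¹) * logRatio M γ w x a o +
      (Cσ : ℝ)⁻¹ / 2 * sqNorm (Δ x a) (γ - w))) ∂(M.obsLaw γ (x, a)) ≤ 1 := by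
  have := M.isMarkovKernel_obsLaw hγ
  -- For `Cσ = 0` the convention `0⁻¹ = 0` makes the integrand equal to one.
  rcases eq_or_ne Cσ 0 with hC | hC
  · simp [hC]
  refine (h.lintegral_exp_le hw x a _ _).trans ?_
  rw [ENNReal.ofReal_le_one, Real.exp_le_one_iff]
  have hC' : (0 : ℝ) < Cσ := NNReal.coe_pos.2 (pos_iff_ne_zero.2 hC)
  have h1 := h.sqNorm_le_klMean hγ hw x a
  have h2 : (Cσ : ℝ) * sqNorm (Δ x a) (γ - w) * (-(Cσ : ℝ)⁻¹) ^ 2 / 2 =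
      (Cσ : ℝ)⁻¹ / 2 * sqNorm (Δ x a) (γ - w) := by field_simp
  rw [h2]
  have := mul_le_mul_of_nonneg_left h1 (inv_nonneg.2 hC'.le)
  linarith

/-- The variance term contributes `1 / 2` and the mean `1` to the factor `3 / 2`, each through its
upper bound by `CΓ * ‖w - γ‖ ^ 2`. -/
theorem lintegral_exp_lower_le_one (h : ObservationModel M γ Δ Cσ CΓ) (hγ : γ ∈ M.Γ)
    (hw : w ∈ M.Γ) (x : X) (a : A) :
    ∫⁻ o, ENNReal.ofReal (Real.exp ((Cσ : ℝ)⁻¹ * logRatio M γ w x a o +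
      -(3 / 2 * (Cσ : ℝ)⁻¹ * CΓ * ‖w - γ‖ ^ 2))) ∂(M.obsLaw γ (x, a)) ≤ 1 := by
  have := M.isMarkovKernel_obsLaw hγ
  rcases eq_or_ne Cσ 0 with hC | hC
  · simp [hC]
  refine (h.lintegral_exp_le hw x a _ _).trans ?_
  rw [ENNReal.ofReal_le_one, Real.exp_le_one_iff]
  have hC' : (0 : ℝ) < Cσ := NNReal.coe_pos.2 (pos_iff_ne_zero.2 hC)
  have h1 := h.sqNorm_le hγ hw x a
  have h3 := h.klMean_le hγ hw x a
  have h2 : (Cσ : ℝ) * sqNorm (Δ x a) (γ - w) * ((Cσ : ℝ)⁻¹) ^ 2 / 2 =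
      (Cσ : ℝ)⁻¹ / 2 * sqNorm (Δ x a) (γ - w) := by field_simp
  rw [h2]
  have e1 := mul_le_mul_of_nonneg_left h1 (inv_nonneg.2 hC'.le)
  have e2 := mul_le_mul_of_nonneg_left h3 (inv_nonneg.2 hC'.le)
  linarith

end ObservationModel

/-! ### Deterministic posterior contraction for a concave log-likelihood -/

section Contraction

variable {d : ℕ} {Γ : Set (Param d)}

theorem map_homothety_volume (c : Param d) {r : ℝ} (hr : 0 < r) :
    (volume : Measure (Param d)).map (fun y => c + r • y) =
      ENNReal.ofReal ((r ^ d)⁻¹) • (volume : Measure (Param d)) := by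
  have h : (fun y : Param d => c + r • y) = (fun y => c + y) ∘ (fun y => r • y) := rfl
  rw [h, ← Measure.map_map (by fun_prop) (by fun_prop), Measure.map_addHaar_smul _ hr.ne',
    Measure.map_smul, map_add_left_eq_self]
  simp [abs_of_pos hr]

/-- Averages over a homothetic copy of `Γ` inside `Γ` are controlled by averages over `Γ`. -/
theorem lintegral_homothety_le (hΓ : MeasurableSet Γ) {c : Param d} {r : ℝ} (hr : 0 < r)
    (hmap : ∀ y ∈ Γ, c + r • y ∈ Γ) {φ : Param d → ℝ≥0∞} (hφ : Measurable φ) :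
    ENNReal.ofReal (r ^ d) * ∫⁻ y, φ (c + r • y) ∂(cond volume Γ) ≤ ∫⁻ y, φ y ∂(cond volume Γ) := by
  have hmeas : Measurable (fun y : Param d => c + r • y) := by fun_prop
  simp only [ProbabilityTheory.cond, lintegral_smul_measure, smul_eq_mul]
  rw [mul_left_comm]
  gcongr
  have h1 : ∫⁻ y in Γ, φ (c + r • y) ≤ ∫⁻ y, Γ.indicator φ (c + r • y) := by
    rw [← lintegral_indicator hΓ]
    refine lintegral_mono fun y => ?_
    by_cases hy : y ∈ Γ
    · rw [Set.indicator_of_mem hy, Set.indicator_of_mem (hmap y hy)]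
    · rw [Set.indicator_of_notMem hy]; simp
  have h2 : ∫⁻ y, Γ.indicator φ (c + r • y) =
      ENNReal.ofReal ((r ^ d)⁻¹) * ∫⁻ y in Γ, φ y := by
    rw [← lintegral_map (hφ.indicator hΓ) hmeas, map_homothety_volume c hr,
      lintegral_smul_measure, lintegral_indicator hΓ, smul_eq_mul]
  calc _ ≤ ENNReal.ofReal (r ^ d) * (ENNReal.ofReal ((r ^ d)⁻¹) * ∫⁻ y in Γ, φ y) := by
        rw [← h2]; gcongr
    _ = _ := by
        rw [← mul_assoc, ← ENNReal.ofReal_mul (by positivity), mul_inv_cancel₀ (by positivity)]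
        simp

/-- Jensen's inequality for negative powers, in exponential form. -/
theorem exp_neg_mul_le_lintegral {Ω : Type*} [MeasurableSpace Ω] {μ : Measure Ω}
    [IsProbabilityMeasure μ] {ψ : Ω → ℝ} (hψ : Measurable ψ) {a p : ℝ} (hp : 0 ≤ p)
    (h : ∫⁻ ω, ENNReal.ofReal (Real.exp (-ψ ω)) ∂μ ≤ ENNReal.ofReal (Real.exp a)) :
    ENNReal.ofReal (Real.exp (-(p * a))) ≤ ∫⁻ ω, ENNReal.ofReal (Real.exp (p * ψ ω)) ∂μ := by
  -- With `u = ψ ω + a` this is `1 + p ≤ exp (p u) + p exp (-u)`, the sum of two tangent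
  -- inequalities, scaled by `exp (-p a)`. On integration the terms with factor `p` cancel by
  -- hypothesis, so no integrability of `ψ` is needed.
  have hpt : ∀ ω, ENNReal.ofReal (Real.exp (-(p * a))) +
      ENNReal.ofReal (p * Real.exp (-(p * a))) ≤
      ENNReal.ofReal (Real.exp (p * ψ ω)) +
        ENNReal.ofReal (p * Real.exp (-(p * a)) * Real.exp (-a)) *
          ENNReal.ofReal (Real.exp (-ψ ω)) := by
    intro ω
    rw [← ENNReal.ofReal_mul (by positivity), ← ENNReal.ofReal_add (by positivity) (by positivity),
      ← ENNReal.ofReal_add (by positivity) (by positivity)]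
    refine ENNReal.ofReal_le_ofReal ?_
    have e1 : Real.exp (p * ψ ω) = Real.exp (-(p * a)) * Real.exp (p * (ψ ω + a)) := by
      rw [← Real.exp_add]; ring_nf
    have e2 : p * Real.exp (-(p * a)) * Real.exp (-a) * Real.exp (-ψ ω) =
        Real.exp (-(p * a)) * (p * Real.exp (-(ψ ω + a))) := by
      rw [show -(ψ ω + a) = -a + -ψ ω by ring, Real.exp_add]; ring
    rw [e1, e2]
    have h1 := Real.add_one_le_exp (p * (ψ ω + a))
    have h2 := mul_le_mul_of_nonneg_left (Real.add_one_le_exp (-(ψ ω + a))) hp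
    nlinarith [Real.exp_pos (-(p * a))]
  have hint := lintegral_mono (μ := μ) hpt
  rw [lintegral_const, measure_univ, mul_one, lintegral_add_left (by fun_prop),
    lintegral_const_mul _ (by fun_prop)] at hint
  have h3 : ENNReal.ofReal (p * Real.exp (-(p * a)) * Real.exp (-a)) *
      ∫⁻ ω, ENNReal.ofReal (Real.exp (-ψ ω)) ∂μ ≤ ENNReal.ofReal (p * Real.exp (-(p * a))) := by
    calc _ ≤ ENNReal.ofReal (p * Real.exp (-(p * a)) * Real.exp (-a)) *
          ENNReal.ofReal (Real.exp a) := by gcongr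
      _ = _ := by
          rw [← ENNReal.ofReal_mul (by positivity), mul_assoc (p * _), ← Real.exp_add]; simp
  exact (ENNReal.add_le_add_iff_right ENNReal.ofReal_ne_top).1
    (hint.trans (add_le_add_right h3 _))

variable {γ : Param d} {G : Param d → ℝ} {γbar C Cσ l : ℝ} {T : ℕ}

theorem scaled_norm_sq_le (hC : 0 < C) {y : Param d} (hy : ‖y - γ‖ ≤ 2 * γbar) :
    C * ‖(invRadius γbar C)⁻¹ • (y - γ)‖ ^ 2 ≤ 1 / 4 := by
  have h1 := one_le_invRadius γbar C
  have h2 : 4 * (γbar * √C) ≤ invRadius γbar C := le_max_right _ _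
  have h3 : √C * ‖(invRadius γbar C)⁻¹ • (y - γ)‖ ≤ 1 / 2 := by
    rw [norm_smul, norm_inv, Real.norm_of_nonneg (by linarith), mul_left_comm,
      inv_mul_le_iff₀ (by linarith)]
    nlinarith [mul_le_mul_of_nonneg_left hy (Real.sqrt_nonneg C)]
  have h4 := pow_le_pow_left₀ (by positivity) h3 2
  rw [mul_pow, Real.sq_sqrt hC.le] at h4
  linarith

theorem ae_mem_cond (hΓ : MeasurableSet Γ) : ∀ᵐ y ∂(cond (volume : Measure (Param d)) Γ), y ∈ Γ := by
  rw [ProbabilityTheory.cond]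
  exact Measure.ae_smul_measure (ae_restrict_mem hΓ) _

/-- The point obtained from `y` by contraction towards `γ`. -/
noncomputable def shrink (γ : Param d) (R : ℝ) (y : Param d) : Param d := γ + R⁻¹ • (y - γ)

theorem shrink_mem (hconv : Convex ℝ Γ) (hγ : γ ∈ Γ) {R : ℝ} (hR : 1 ≤ R) {y : Param d}
    (hy : y ∈ Γ) : shrink γ R y ∈ Γ :=
  hconv.add_smul_sub_mem hγ hy ⟨by positivity, inv_le_one_of_one_le₀ hR⟩

theorem measurable_shrink (γ : Param d) (R : ℝ) : Measurable (shrink γ R) := by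
  unfold shrink; fun_prop

/-- On the shrunk copy the quadratic penalty is at most `3 / 2 * 1 / 4 = 3 / 8` times `Cσ⁻¹`, so it
can be dropped at a constant cost. -/
theorem shrink_lintegral_le (hΓ : MeasurableSet Γ) (hbd : ∀ y ∈ Γ, ‖y - γ‖ ≤ 2 * γbar)
    (hC : 0 < C) (hCσ : 0 < Cσ) (hT : 1 ≤ T)
    (hB : ∫⁻ y, ENNReal.ofReal (Real.exp (-(Cσ⁻¹ * G (shrink γ (invRadius γbar C) y)) -
      3 / 2 * Cσ⁻¹ * C * ‖shrink γ (invRadius γbar C) y - γ‖ ^ 2)) ∂(cond volume Γ) ≤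
        ENNReal.ofReal (2 * T)) :
    ∫⁻ y, ENNReal.ofReal (Real.exp (-(Cσ⁻¹ * G (shrink γ (invRadius γbar C) y))))
      ∂(cond volume Γ) ≤ ENNReal.ofReal (Real.exp (Real.log (2 * T) + 3 / 8 * Cσ⁻¹)) := by
  have hT' : (1 : ℝ) ≤ T := by exact_mod_cast hT
  have hs : 0 < Cσ⁻¹ := inv_pos.2 hCσ
  rw [Real.exp_add, Real.exp_log (by positivity), mul_comm, ENNReal.ofReal_mul (Real.exp_pos _).le]
  refine le_trans ?_ (mul_le_mul_right hB _)
  rw [← lintegral_const_mul' _ _ ENNReal.ofReal_ne_top]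
  refine lintegral_mono_ae ?_
  filter_upwards [ae_mem_cond hΓ] with y hy
  rw [← ENNReal.ofReal_mul (Real.exp_pos _).le, ← Real.exp_add]
  refine ENNReal.ofReal_le_ofReal (Real.exp_le_exp.2 ?_)
  have h1 := scaled_norm_sq_le (γ := γ) hC (hbd y hy)
  have h2 : shrink γ (invRadius γbar C) y - γ = (invRadius γbar C)⁻¹ • (y - γ) := by
    simp [shrink]
  rw [h2]
  nlinarith [mul_le_mul_of_nonneg_left h1 hs.le]

/-- A lower bound on the evidence. -/
theorem evidence_ge [IsProbabilityMeasure (cond (volume : Measure (Param d)) Γ)]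
    (hΓ : MeasurableSet Γ) (hconv : Convex ℝ Γ) (hγ : γ ∈ Γ) (hG : Measurable G)
    (hCσ : 0 < Cσ) {R a : ℝ} (hR : 1 ≤ R)
    (hB : ∫⁻ y, ENNReal.ofReal (Real.exp (-(Cσ⁻¹ * G (shrink γ R y)))) ∂(cond volume Γ) ≤
      ENNReal.ofReal (Real.exp a)) :
    ENNReal.ofReal (Real.exp (-(d * Real.log R) - Cσ * a)) ≤
      ∫⁻ y, ENNReal.ofReal (Real.exp (G y)) ∂(cond volume Γ) := by
  have h0 : ∀ y, shrink γ R y = (γ - R⁻¹ • γ) + R⁻¹ • y := fun y => by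
    unfold shrink; module
  -- The power `Cσ` undoes the exponent `1 / Cσ` and returns the likelihood itself.
  have h1 := exp_neg_mul_le_lintegral (p := Cσ)
    ((hG.comp (measurable_shrink γ R)).const_mul Cσ⁻¹) hCσ.le hB
  have h2 := lintegral_homothety_le hΓ (c := γ - R⁻¹ • γ) (r := R⁻¹) (by positivity)
    (fun y hy => by rw [← h0]; exact shrink_mem hconv hγ hR hy) hG.exp.ennreal_ofReal
  refine le_trans ?_ h2
  have h3 : Real.exp (-(d * Real.log R) - Cσ * a) = R⁻¹ ^ d * Real.exp (-(Cσ * a)) := by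
    rw [sub_eq_add_neg, Real.exp_add, inv_pow, Real.exp_neg, ← Real.log_pow,
      Real.exp_log (by positivity)]
  rw [h3, ENNReal.ofReal_mul (by positivity)]
  gcongr
  refine h1.trans (le_of_eq (lintegral_congr fun y => ?_))
  rw [Function.comp_apply, mul_inv_cancel_left₀ hCσ.ne', h0]

/-- A pointwise upper bound on the log-likelihood away from `γ`. -/
theorem logLikelihood_le [IsProbabilityMeasure (cond (volume : Measure (Param d)) Γ)]
    (hΓ : MeasurableSet Γ) (hconc : ConcaveOn ℝ Γ G) (hγ : γ ∈ Γ)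
    (hG : Measurable G) (hCσ : 0 < Cσ) (hl : 0 < l) {R a : ℝ} (hR : 1 ≤ R) (hT : 1 ≤ T)
    (hA : ∫⁻ y, ENNReal.ofReal (Real.exp (Cσ⁻¹ * G y + Cσ⁻¹ / 2 * (l * ‖y - γ‖ ^ 2)))
      ∂(cond volume Γ) ≤ ENNReal.ofReal (2 * T))
    (hB : ∫⁻ y, ENNReal.ofReal (Real.exp (-(Cσ⁻¹ * G (shrink γ R y)))) ∂(cond volume Γ) ≤
      ENNReal.ofReal (Real.exp a))
    {w : Param d} (hw : w ∈ Γ) (hfar : ∀ y ∈ Γ, 16 * ‖shrink γ R y - γ‖ ^ 2 ≤ ‖w - γ‖ ^ 2) :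
    G w ≤ -(l * ‖w - γ‖ ^ 2 / 8) +
      2 * Cσ * (d * Real.log (2 * R) + Real.log (2 * T) + a / 2) := by
  have hT' : (1 : ℝ) ≤ T := by exact_mod_cast hT
  have hs : 0 < Cσ⁻¹ := inv_pos.2 hCσ
  set s := Cσ⁻¹ with hsdef
  have h0 : ∀ y, (1 / 2 : ℝ) • w + (1 / 2 : ℝ) • shrink γ R y =
      ((1 / 2 : ℝ) • w + (1 / 2 : ℝ) • (γ - R⁻¹ • γ)) + (2 * R)⁻¹ • y := fun y => by
    unfold shrink; rw [mul_inv]; module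
  have hu : ∀ y ∈ Γ, (1 / 2 : ℝ) • w + (1 / 2 : ℝ) • shrink γ R y ∈ Γ := fun y hy =>
    hconc.1 hw (shrink_mem hconc.1 hγ hR hy) (by norm_num) (by norm_num) (by norm_num)
  -- The power is `1 / 2` because the shrunk point has weight one half in the midpoint.
  have h1 := exp_neg_mul_le_lintegral (p := 1 / 2)
    ((hG.comp (measurable_shrink γ R)).const_mul s) (by norm_num) hB
  have h2 := lintegral_homothety_le hΓ (c := (1 / 2 : ℝ) • w + (1 / 2 : ℝ) • (γ - R⁻¹ • γ))
    (r := (2 * R)⁻¹) (by positivity) (fun y hy => by rw [← h0]; exact hu y hy)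
    (φ := fun y => ENNReal.ofReal (Real.exp (s * G y + s / 2 * (l * ‖y - γ‖ ^ 2))))
    (by fun_prop)
  have h3 : ENNReal.ofReal (Real.exp (s / 2 * G w + s / 16 * (l * ‖w - γ‖ ^ 2))) *
      ∫⁻ y, ENNReal.ofReal (Real.exp (1 / 2 * (s * G (shrink γ R y)))) ∂(cond volume Γ) ≤
      ∫⁻ y, ENNReal.ofReal (Real.exp (s * G ((1 / 2 : ℝ) • w + (1 / 2 : ℝ) • shrink γ R y) +
        s / 2 * (l * ‖(1 / 2 : ℝ) • w + (1 / 2 : ℝ) • shrink γ R y - γ‖ ^ 2)))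
        ∂(cond volume Γ) := by
    rw [← lintegral_const_mul' _ _ ENNReal.ofReal_ne_top]
    refine lintegral_mono_ae ?_
    filter_upwards [ae_mem_cond hΓ] with y hy
    rw [← ENNReal.ofReal_mul (Real.exp_pos _).le, ← Real.exp_add]
    refine ENNReal.ofReal_le_ofReal (Real.exp_le_exp.2 ?_)
    have e1 := hconc.2 hw (shrink_mem hconc.1 hγ hR hy) (show (0 : ℝ) ≤ 1 / 2 by norm_num)
      (show (0 : ℝ) ≤ 1 / 2 by norm_num) (by norm_num)
    simp only [smul_eq_mul] at e1
    have e2 : (1 / 2 : ℝ) • w + (1 / 2 : ℝ) • shrink γ R y - γ =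
        (1 / 2 : ℝ) • ((w - γ) - -(shrink γ R y - γ)) := by module
    have e3 := norm_sub_norm_le (w - γ) (-(shrink γ R y - γ))
    have e4 : 4 * ‖shrink γ R y - γ‖ ≤ ‖w - γ‖ := by
      have := hfar y hy
      refine le_of_sq_le_sq ?_ (norm_nonneg _)
      linarith
    -- The midpoint keeps at least `1 / 2 * 3 / 4` of the distance from `w` to `γ`, and `9 / 64 ≥ 1
    -- / 8`.
    have e5 : ‖w - γ‖ ^ 2 / 8 ≤ ‖(1 / 2 : ℝ) • w + (1 / 2 : ℝ) • shrink γ R y - γ‖ ^ 2 := by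
      rw [e2, norm_smul, mul_pow, Real.norm_of_nonneg (by norm_num)]
      rw [norm_neg] at e3
      have e6 : 3 / 4 * ‖w - γ‖ ≤ ‖(w - γ) - -(shrink γ R y - γ)‖ := by linarith
      have e7 := pow_le_pow_left₀ (by positivity) e6 2
      nlinarith [sq_nonneg ‖w - γ‖]
    have e8 := mul_le_mul_of_nonneg_left e1 hs.le
    have e9 := mul_le_mul_of_nonneg_left (mul_le_mul_of_nonneg_left e5 hl.le)
      (show 0 ≤ s / 2 by positivity)
    linarith
  have h4 : ENNReal.ofReal ((2 * R)⁻¹ ^ d * (Real.exp (s / 2 * G w + s / 16 *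
      (l * ‖w - γ‖ ^ 2)) * Real.exp (-(1 / 2 * a)))) ≤ ENNReal.ofReal (2 * T) := by
    rw [ENNReal.ofReal_mul (by positivity), ENNReal.ofReal_mul (by positivity)]
    refine le_trans ?_ (h2.trans hA)
    refine mul_le_mul_right (le_trans ?_ (h3.trans (le_of_eq ?_))) _
    · exact mul_le_mul_right h1 _
    · exact lintegral_congr fun y => by rw [h0]
  rw [ENNReal.ofReal_le_ofReal_iff (by positivity)] at h4
  have h5 := Real.log_le_log (by positivity) h4
  rw [Real.log_mul (by positivity) (by positivity), ← Real.exp_add, Real.log_exp, Real.log_pow,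
    Real.log_inv] at h5
  have h6 : s * Cσ = 1 := inv_mul_cancel₀ hCσ.ne'
  have h7 := mul_le_mul_of_nonneg_left h5 (show 0 ≤ 2 * Cσ by positivity)
  have h8 : 2 * Cσ * (d * -Real.log (2 * R) + (s / 2 * G w + s / 16 * (l * ‖w - γ‖ ^ 2) +
      -(1 / 2 * a))) = 2 * Cσ * (d * -Real.log (2 * R)) + (s * Cσ) * G w +
      (s * Cσ) * (l * ‖w - γ‖ ^ 2 / 8) - Cσ * a := by ring
  rw [h8, h6] at h7
  linarith

theorem mul_exp_neg_le {x M : ℝ} (hM : 1 ≤ M) (hx : M ≤ x) : x * Real.exp (M - x) ≤ M := by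
  have h1 := Real.add_one_le_exp (x - M)
  have h2 : x ≤ M * Real.exp (x - M) := by nlinarith
  calc x * Real.exp (M - x) ≤ M * Real.exp (x - M) * Real.exp (M - x) := by gcongr
    _ = M := by rw [mul_assoc, ← Real.exp_add]; simp

/-- Posterior contraction on the event that two likelihood-ratio averages are not too large. -/
theorem secondMoment_le [IsProbabilityMeasure (cond (volume : Measure (Param d)) Γ)]
    (hΓ : MeasurableSet Γ) (hbd : ∀ y ∈ Γ, ‖y - γ‖ ≤ 2 * γbar)
    (hconc : ConcaveOn ℝ Γ G) (hγ : γ ∈ Γ) (hG : Measurable G) (hCσ : 2 ≤ Cσ) (hl : 0 < l)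
    (hlC : l ≤ C) (hT : 1 ≤ T)
    (hA : ∫⁻ y, ENNReal.ofReal (Real.exp (Cσ⁻¹ * G y + Cσ⁻¹ / 2 * (l * ‖y - γ‖ ^ 2)))
      ∂(cond volume Γ) ≤ ENNReal.ofReal (2 * T))
    (hB : ∫⁻ y, ENNReal.ofReal (Real.exp (-(Cσ⁻¹ * G (shrink γ (invRadius γbar C) y)) -
      3 / 2 * Cσ⁻¹ * C * ‖shrink γ (invRadius γbar C) y - γ‖ ^ 2)) ∂(cond volume Γ) ≤
        ENNReal.ofReal (2 * T)) :
    ∫⁻ y, ENNReal.ofReal (‖γ - y‖ ^ 2) * ENNReal.ofReal (Real.exp (G y)) ∂(cond volume Γ) ≤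
      ENNReal.ofReal (16 / l * tailExponent d T γbar C Cσ) *
        ∫⁻ y, ENNReal.ofReal (Real.exp (G y)) ∂(cond volume Γ) := by
  have hC : 0 < C := hl.trans_le hlC
  have hCσ0 : 0 < Cσ := by linarith
  set R := invRadius γbar C with hRdef
  set M := tailExponent d T γbar C Cσ with hMdef
  have hR : 1 ≤ R := one_le_invRadius _ _
  have hM : 1 ≤ M := one_le_tailExponent hT hCσ _ _
  set a := Real.log (2 * T) + 3 / 8 * Cσ⁻¹ with ha
  have hB' := shrink_lintegral_le hΓ hbd hC hCσ0 hT hB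
  have hN := evidence_ge hΓ hconc.1 hγ hG hCσ0 hR hB'
  set ν := Real.exp (-(d * Real.log R) - Cσ * a) with hν
  -- Near `γ` the first summand suffices. Far away the likelihood is at most `ν * exp (M - x)` with
  -- `x = l‖y - γ‖² / 8 ≥ M`, and `x * exp (M - x) ≤ M`. As `ν` is a lower bound for the evidence,
  -- integration yields twice `8 / l * M` times the evidence.
  have hpt : ∀ y ∈ Γ, ‖γ - y‖ ^ 2 * Real.exp (G y) ≤ 8 / l * M * (Real.exp (G y) + ν) := by
    intro y hy
    have hν0 : 0 < ν := Real.exp_pos _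
    rw [norm_sub_rev]
    rcases le_or_gt (‖y - γ‖ ^ 2) (8 / l * M) with h | h
    · have h1 : ‖y - γ‖ ^ 2 * Real.exp (G y) ≤ 8 / l * M * Real.exp (G y) := by gcongr
      have h2 : 0 ≤ 8 / l * M * ν := by positivity
      linarith
    · have hxM : M ≤ l * ‖y - γ‖ ^ 2 / 8 := by
        have : l * (8 / l * M) ≤ l * ‖y - γ‖ ^ 2 := by gcongr
        have e : l * (8 / l * M) = 8 * M := by field_simp
        linarith
      have hfar : ∀ z ∈ Γ, 16 * ‖shrink γ R z - γ‖ ^ 2 ≤ ‖y - γ‖ ^ 2 := by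
        intro z hz
        have h1 := scaled_norm_sq_le (γ := γ) hC (hbd z hz)
        have h2 : shrink γ R z - γ = R⁻¹ • (z - γ) := by simp [shrink]
        rw [h2]
        have h3 : l * ‖R⁻¹ • (z - γ)‖ ^ 2 ≤ 1 / 4 :=
          (mul_le_mul_of_nonneg_right hlC (sq_nonneg _)).trans h1
        refine le_of_mul_le_mul_left ?_ hl
        linarith
      have h1 := logLikelihood_le hΓ hconc hγ hG hCσ0 hl hR hT hA hB' hy hfar
      have hCs : Cσ * Cσ⁻¹ = 1 := mul_inv_cancel₀ hCσ0.ne'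
      -- `tailExponent` is defined to make this an identity: the bound of `logLikelihood_le` divided
      -- by the evidence bound `ν`.
      have h2 : G y ≤ (M - l * ‖y - γ‖ ^ 2 / 8) + (-(d * Real.log R) - Cσ * a) := by
        refine h1.trans (le_of_eq ?_)
        rw [hMdef, tailExponent, ha]
        linear_combination (3 / 8 + 3 / 8) * hCs
      have h3 := mul_exp_neg_le hM hxM
      calc ‖y - γ‖ ^ 2 * Real.exp (G y)
          ≤ ‖y - γ‖ ^ 2 * (Real.exp (M - l * ‖y - γ‖ ^ 2 / 8) * ν) := by
            rw [hν, ← Real.exp_add]; gcongr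
        _ = 8 / l * (l * ‖y - γ‖ ^ 2 / 8 * Real.exp (M - l * ‖y - γ‖ ^ 2 / 8)) * ν := by
            field_simp
        _ ≤ 8 / l * M * ν := by gcongr
        _ ≤ _ := by
            have : 0 ≤ 8 / l * M * Real.exp (G y) := by positivity
            linarith
  calc _ ≤ ∫⁻ y, ENNReal.ofReal (8 / l * M) * (ENNReal.ofReal (Real.exp (G y)) +
        ENNReal.ofReal ν) ∂(cond volume Γ) := by
        refine lintegral_mono_ae ?_
        filter_upwards [ae_mem_cond hΓ] with y hy
        rw [← ENNReal.ofReal_mul (by positivity), ← ENNReal.ofReal_add (by positivity)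
          (by positivity), ← ENNReal.ofReal_mul (by positivity)]
        exact ENNReal.ofReal_le_ofReal (hpt y hy)
    _ = ENNReal.ofReal (8 / l * M) * (∫⁻ y, ENNReal.ofReal (Real.exp (G y)) ∂(cond volume Γ) +
        ENNReal.ofReal ν) := by
        rw [lintegral_const_mul' _ _ ENNReal.ofReal_ne_top, lintegral_add_right _ (by fun_prop)]
        simp
    _ ≤ ENNReal.ofReal (8 / l * M) * (∫⁻ y, ENNReal.ofReal (Real.exp (G y)) ∂(cond volume Γ) +
        ∫⁻ y, ENNReal.ofReal (Real.exp (G y)) ∂(cond volume Γ)) := by gcongr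
    _ = _ := by
        have h16 : ENNReal.ofReal (16 / l * M) =
            ENNReal.ofReal (8 / l * M) + ENNReal.ofReal (8 / l * M) := by
          rw [← ENNReal.ofReal_add (by positivity) (by positivity)]
          congr 1; ring
        rw [h16, mul_add, add_mul]

end Contraction

/-! ### The posterior, the bad event and contraction outside of it -/

section Posterior

variable {d : ℕ} {X A O : Type*} [MeasurableSpace X] [MeasurableSpace A] [MeasurableSpace O]
  {M : Model d X A O} {γ : Param d} {γbar rbar CΓ : ℝ} {Cσ : ℝ≥0}
  {Δ : X → A → Matrix (Fin d) (Fin d) ℝ}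

namespace EnvironmentSpace

theorem dim_pos (hE : EnvironmentSpace M γbar rbar) : 0 < d := by
  rcases Nat.eq_zero_or_pos d with h | h
  · have := hE.one_le
    norm_num [h] at this
  · exact h

theorem volume_ne_top (hE : EnvironmentSpace M γbar rbar) : volume M.Γ ≠ ∞ := by
  refine ne_top_of_le_ne_top ?_ (measure_mono (t := Metric.closedBall 0 γbar) fun w hw => ?_)
  · exact measure_closedBall_lt_top.ne
  · simpa using hE.norm_le w hw

theorem isProbabilityMeasure_prior (hE : EnvironmentSpace M γbar rbar) :
    IsProbabilityMeasure M.prior :=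
  cond_isProbabilityMeasure_of_finite hE.volume_ne_zero hE.volume_ne_top

theorem norm_sub_le (hE : EnvironmentSpace M γbar rbar) (hγ : γ ∈ M.Γ) {w : Param d}
    (hw : w ∈ M.Γ) : ‖w - γ‖ ≤ 2 * γbar := by
  have h1 := _root_.norm_sub_le w γ
  linarith [hE.norm_le w hw, hE.norm_le γ hγ]

theorem volume_singleton (hE : EnvironmentSpace M γbar rbar) (w : Param d) :
    (volume : Measure (Param d)) {w} = 0 := by
  have : Nonempty (Fin d) := ⟨⟨0, hE.dim_pos⟩⟩
  exact measure_singleton w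

/-- A second environment gives a direction in which the assumptions on `Δ` can be tested. -/
theorem exists_ne (hE : EnvironmentSpace M γbar rbar) (γ : Param d) : ∃ w ∈ M.Γ, w ≠ γ := by
  by_contra! h
  exact hE.volume_ne_zero (measure_mono_null h (hE.volume_singleton γ))

end EnvironmentSpace

section Lam

theorem lam_castLE {n T : ℕ} (h : n ≤ T) (ω : Fin T → Round X A O) :
    lam Δ (fun i : Fin n => ω (i.castLE h)) n = lam Δ ω n := by
  unfold lam
  congr 1
  rw [← Finset.sum_filter, ← Finset.sum_filter]
  refine Finset.sum_bij (fun i _ => i.castLE h) ?_ ?_ ?_ ?_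
  · intro i hi; simp
  · intro i _ j _ hij; simpa using hij
  · intro j hj
    simp only [Finset.mem_filter, Finset.mem_univ, true_and] at hj
    exact ⟨⟨j, hj⟩, by simp, by ext; simp⟩
  · intro i _; rfl

theorem posSemidef_lam (hO : ObservationModel M γ Δ Cσ CΓ) {T : ℕ} (ω : Fin T → Round X A O)
    (t : ℕ) :
    (∑ i : Fin T, if (i : ℕ) < t then Δ (ω i).1.1 (ω i).1.2 else 0).PosSemidef := by
  refine Matrix.posSemidef_sum _ fun i _ => ?_
  split_ifs
  · exact hO.posSemidef _ _
  · exact Matrix.PosSemidef.zero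

theorem lam_mul_le (hd : 0 < d) (hO : ObservationModel M γ Δ Cσ CΓ) {n : ℕ}
    (ω : Fin n → Round X A O) (v : Param d) :
    lam Δ ω n * ‖v‖ ^ 2 ≤ ∑ i, sqNorm (Δ (ω i).1.1 (ω i).1.2) v := by
  refine (minEigenvalue_mul_le hd (posSemidef_lam hO ω n).1 v).trans (le_of_eq ?_)
  rw [sqNorm_sum]
  simp

theorem lam_mono (hd : 0 < d) (hO : ObservationModel M γ Δ Cσ CΓ) {T : ℕ}
    (ω : Fin T → Round X A O) : Monotone (lam Δ ω) := by
  intro s t hst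
  refine (le_minEigenvalue_iff hd (posSemidef_lam hO ω t).1 _).2 fun v => ?_
  refine (minEigenvalue_mul_le hd (posSemidef_lam hO ω s).1 v).trans ?_
  rw [sqNorm_sum, sqNorm_sum]
  refine Finset.sum_le_sum fun i _ => ?_
  by_cases h : (i : ℕ) < s
  · rw [if_pos h, if_pos (h.trans_le hst)]
  · rw [if_neg h, sqNorm_zero]
    split_ifs
    · exact sqNorm_nonneg (hO.posSemidef _ _) v
    · rw [sqNorm_zero]

theorem lam_zero_le (hd : 0 < d) {T : ℕ} (ω : Fin T → Round X A O) : lam Δ ω 0 ≤ 0 := by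
  have h := minEigenvalue_mul_le hd (Matrix.isHermitian_zero (n := Fin d) (α := ℝ))
    (EuclideanSpace.single ⟨0, hd⟩ 1)
  simpa [sqNorm_zero, lam] using h

theorem measurable_lam (hd : 0 < d) (hO : ObservationModel M γ Δ Cσ CΓ) (T t : ℕ) :
    Measurable fun ω : Fin T → Round X A O => lam Δ ω t := by
  refine measurable_minEigenvalue hd (fun ω => (posSemidef_lam hO ω t).1) fun i j => ?_
  simp only [Matrix.sum_apply]
  refine Finset.measurable_sum _ fun k _ => ?_
  split_ifs
  · exact (hO.measurable i j).comp (f := fun ω : Fin T → Round X A O => (ω k).1) (by fun_prop)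
  · exact measurable_const

/-- Each round adds at most `CΓ * ‖w - γ‖ ^ 2` to the quadratic form at `γ - w`, since the squared
norm is below the KL divergence. This keeps `coverRatio` at least two. -/
theorem lam_le (hE : EnvironmentSpace M γbar rbar) (hO : ObservationModel M γ Δ Cσ CΓ)
    (hγ : γ ∈ M.Γ) {n : ℕ} (ω : Fin n → Round X A O) : lam Δ ω n ≤ CΓ * n := by
  obtain ⟨w, hw, hne⟩ := hE.exists_ne γ
  have h1 := lam_mul_le hE.dim_pos hO ω (γ - w)
  have h2 : ∑ i, sqNorm (Δ (ω i).1.1 (ω i).1.2) (γ - w) ≤ ∑ _i : Fin n, CΓ * ‖w - γ‖ ^ 2 :=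
    Finset.sum_le_sum fun i _ => hO.sqNorm_le hγ hw _ _
  have h3 : 0 < ‖w - γ‖ ^ 2 := by
    have := norm_pos_iff.2 (sub_ne_zero.2 hne)
    positivity
  rw [norm_sub_rev] at h1
  simp only [Finset.sum_const, Finset.card_univ, Fintype.card_fin, nsmul_eq_mul] at h2
  refine le_of_mul_le_mul_right ?_ h3
  linarith

theorem two_le_variance_of_lam_pos (hE : EnvironmentSpace M γbar rbar)
    (hO : ObservationModel M γ Δ Cσ CΓ) (hγ : γ ∈ M.Γ) {n : ℕ} (ω : Fin n → Round X A O)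
    (hl : 0 < lam Δ ω n) : (2 : ℝ) ≤ Cσ := by
  obtain ⟨w, hw, hne⟩ := hE.exists_ne γ
  have h1 := lam_mul_le hE.dim_pos hO ω (γ - w)
  have h3 : 0 < ‖γ - w‖ := norm_pos_iff.2 (sub_ne_zero.2 hne.symm)
  have h4 : 0 < ∑ i, sqNorm (Δ (ω i).1.1 (ω i).1.2) (γ - w) := lt_of_lt_of_le (by positivity) h1
  obtain ⟨i, _, hi⟩ := Finset.exists_lt_of_sum_lt (s := Finset.univ)
    (f := fun _ : Fin n => (0 : ℝ)) (by simpa using h4)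
  exact hO.two_le_variance hγ hw _ _ hi

end Lam

section Likelihood

/-- The log-likelihood of the first rounds relative to the true environment. -/
noncomputable def relLogLik (M : Model d X A O) (γ : Param d) {n : ℕ} (ω : Fin n → Round X A O)
    (w : Param d) : ℝ :=
  ∑ i, -logRatio M γ w (ω i).1.1 (ω i).1.2 (ω i).2

theorem measurable_relLogLik (M : Model d X A O) (γ : Param d) {n : ℕ}
    (ω : Fin n → Round X A O) : Measurable (relLogLik M γ ω) :=
  Finset.measurable_sum _ fun i _ =>
    ((M.measurable_logRatio_uncurry γ).comp (f := fun w => (w, ω i)) (by fun_prop)).fun_neg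

theorem concaveOn_relLogLik (hO : ObservationModel M γ Δ Cσ CΓ) (hγ : γ ∈ M.Γ)
    (hconv : Convex ℝ M.Γ) {n : ℕ} (ω : Fin n → Round X A O) :
    ConcaveOn ℝ M.Γ (relLogLik M γ ω) := by
  refine ⟨hconv, fun x hx y hy a b ha hb hab => ?_⟩
  simp only [relLogLik, smul_eq_mul, Finset.mul_sum, ← Finset.sum_add_distrib]
  refine Finset.sum_le_sum fun i _ => ?_
  have h := (hO.concave (ω i).1.1 (ω i).1.2 (ω i).2).2 hx hy ha hb hab
  rw [M.logRatio_eq hγ hx, M.logRatio_eq hγ hy, M.logRatio_eq hγ (hconv hx hy ha hb hab)]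
  simp only [smul_eq_mul] at h
  have hb' : b = 1 - a := by linarith
  subst hb'
  linarith

theorem likelihood_pos (hγ : γ ∈ M.Γ) {n : ℕ} (h : History X A O n) : 0 < M.likelihood h γ :=
  mul_pos (mul_pos (Finset.prod_pos fun _ _ => M.ctxDens_pos γ hγ _) (M.ctxDens_pos γ hγ _))
    (Finset.prod_pos fun _ _ => M.obsDens_pos γ hγ _ _ _)

theorem likelihood_eq (hE : EnvironmentSpace M γbar rbar) (hγ : γ ∈ M.Γ) {w : Param d}
    (hw : w ∈ M.Γ) {n : ℕ} (h : History X A O n) :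
    M.likelihood h w = M.likelihood h γ * Real.exp (relLogLik M γ h.1 w) := by
  have hobs : ∏ i, M.obsDens w (h.1 i).1.1 (h.1 i).1.2 (h.1 i).2 =
      (∏ i, M.obsDens γ (h.1 i).1.1 (h.1 i).1.2 (h.1 i).2) *
        Real.exp (relLogLik M γ h.1 w) := by
    rw [relLogLik, Real.exp_sum, ← Finset.prod_mul_distrib]
    refine Finset.prod_congr rfl fun i _ => ?_
    rw [M.exp_neg_logRatio hγ hw, mul_div_cancel₀ _ (M.obsDens_pos γ hγ _ _ _).ne']
  have hctx : ∀ x, M.ctxDens w x = M.ctxDens γ x := hE.ctx_eq w hw γ hγ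
  simp only [Model.likelihood, hobs, hctx, mul_assoc]

theorem measurable_likelihood (M : Model d X A O) {n : ℕ} (h : History X A O n) :
    Measurable (M.likelihood h) := by
  have h1 : ∀ x, Measurable fun w => M.ctxDens w x := fun x =>
    M.ctxDens_measurable.comp (f := fun w => (w, x)) (by fun_prop)
  have h2 : ∀ r : Round X A O, Measurable fun w => M.obsDens w r.1.1 r.1.2 r.2 := fun r =>
    M.obsDens_measurable.comp (f := fun w => (w, r)) (by fun_prop)
  unfold Model.likelihood
  exact ((Finset.measurable_prod _ fun i _ => h1 _).mul (h1 _)).mul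
    (Finset.measurable_prod _ fun i _ => h2 _)

/-- The likelihood of `γ`, which contains the common context densities, cancels from numerator and
normalization. -/
theorem lintegral_posterior (hE : EnvironmentSpace M γbar rbar) (hγ : γ ∈ M.Γ) {n : ℕ}
    (h : History X A O n) {φ : Param d → ℝ≥0∞} (hφ : Measurable φ) :
    ∫⁻ w, φ w ∂(M.posterior h) =
      (∫⁻ w, ENNReal.ofReal (Real.exp (relLogLik M γ h.1 w)) ∂M.prior)⁻¹ *
        ∫⁻ w, φ w * ENNReal.ofReal (Real.exp (relLogLik M γ h.1 w)) ∂M.prior := by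
  have hmem : ∀ᵐ w ∂M.prior, w ∈ M.Γ := ae_mem_cond hE.measurableSet
  have hc0 : ENNReal.ofReal (M.likelihood h γ) ≠ 0 :=
    (ENNReal.ofReal_pos.2 (likelihood_pos hγ h)).ne'
  have h1 : ∫⁻ w, ENNReal.ofReal (M.likelihood h w) ∂M.prior =
      ENNReal.ofReal (M.likelihood h γ) *
        ∫⁻ w, ENNReal.ofReal (Real.exp (relLogLik M γ h.1 w)) ∂M.prior := by
    rw [← lintegral_const_mul' _ _ ENNReal.ofReal_ne_top]
    refine lintegral_congr_ae ?_
    filter_upwards [hmem] with w hw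
    rw [likelihood_eq hE hγ hw, ENNReal.ofReal_mul (likelihood_pos hγ h).le]
  have h2 : ∫⁻ w, ENNReal.ofReal (M.likelihood h w) * φ w ∂M.prior =
      ENNReal.ofReal (M.likelihood h γ) *
        ∫⁻ w, φ w * ENNReal.ofReal (Real.exp (relLogLik M γ h.1 w)) ∂M.prior := by
    rw [← lintegral_const_mul' _ _ ENNReal.ofReal_ne_top]
    refine lintegral_congr_ae ?_
    filter_upwards [hmem] with w hw
    rw [likelihood_eq hE hγ hw, ENNReal.ofReal_mul (likelihood_pos hγ h).le]
    ring
  rw [Model.posterior, lintegral_smul_measure, lintegral_withDensity_eq_lintegral_mul _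
    (measurable_likelihood M h).ennreal_ofReal hφ, smul_eq_mul, h1]
  simp only [Pi.mul_apply]
  rw [h2, ENNReal.mul_inv (Or.inl hc0) (Or.inl ENNReal.ofReal_ne_top), mul_mul_mul_comm,
    ENNReal.inv_mul_cancel hc0 ENNReal.ofReal_ne_top, one_mul]

theorem posterior_secondMoment_le (hE : EnvironmentSpace M γbar rbar) (hγ : γ ∈ M.Γ) {n : ℕ}
    (h : History X A O n) {b : ℝ} (hb : 0 ≤ b)
    (hle : ∫⁻ w, ENNReal.ofReal (‖γ - w‖ ^ 2) *
        ENNReal.ofReal (Real.exp (relLogLik M γ h.1 w)) ∂M.prior ≤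
      ENNReal.ofReal b * ∫⁻ w, ENNReal.ofReal (Real.exp (relLogLik M γ h.1 w)) ∂M.prior) :
    ∫ w, ‖γ - w‖ ^ 2 ∂(M.posterior h) ≤ b := by
  rw [integral_eq_lintegral_of_nonneg_ae (Filter.Eventually.of_forall fun w => by positivity)
    (by fun_prop), lintegral_posterior hE hγ h (by fun_prop)]
  refine ENNReal.toReal_le_of_le_ofReal hb ?_
  calc _ ≤ (∫⁻ w, ENNReal.ofReal (Real.exp (relLogLik M γ h.1 w)) ∂M.prior)⁻¹ *
        (ENNReal.ofReal b * ∫⁻ w, ENNReal.ofReal (Real.exp (relLogLik M γ h.1 w)) ∂M.prior) := by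
        gcongr
    _ = ENNReal.ofReal b * ((∫⁻ w, ENNReal.ofReal (Real.exp (relLogLik M γ h.1 w)) ∂M.prior)⁻¹ *
        ∫⁻ w, ENNReal.ofReal (Real.exp (relLogLik M γ h.1 w)) ∂M.prior) := by ring
    -- The inequality also covers evidence `0` or `∞`, so neither has to be excluded.
    _ ≤ ENNReal.ofReal b := mul_le_of_le_one_right' (ENNReal.inv_mul_le_one _)

theorem posterior_secondMoment_le_const (hE : EnvironmentSpace M γbar rbar) (hγ : γ ∈ M.Γ) {n : ℕ}
    (h : History X A O n) : ∫ w, ‖γ - w‖ ^ 2 ∂(M.posterior h) ≤ 4 * γbar ^ 2 := by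
  refine posterior_secondMoment_le hE hγ h (by positivity) ?_
  rw [← lintegral_const_mul' _ _ ENNReal.ofReal_ne_top]
  refine lintegral_mono_ae ?_
  filter_upwards [ae_mem_cond hE.measurableSet] with w hw
  gcongr
  have h1 := hE.norm_sub_le hγ hw
  rw [norm_sub_rev]
  calc ‖w - γ‖ ^ 2 ≤ (2 * γbar) ^ 2 := by gcongr
    _ = _ := by ring

/-- Before the first round the posterior is not concentrated at `γ`. -/
theorem posterior_secondMoment_pos (hE : EnvironmentSpace M γbar rbar) (hγ : γ ∈ M.Γ)
    (h : History X A O 0) : 0 < ∫ w, ‖γ - w‖ ^ 2 ∂(M.posterior h) := by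
  have := hE.isProbabilityMeasure_prior
  have h0 : ∀ w, relLogLik M γ h.1 w = 0 := fun w => by simp [relLogLik]
  have h1 := lintegral_posterior hE hγ h (φ := fun w => ENNReal.ofReal (‖γ - w‖ ^ 2))
    (by fun_prop)
  simp only [h0, Real.exp_zero, ENNReal.ofReal_one, mul_one, lintegral_const, measure_univ,
    inv_one, one_mul] at h1
  rw [integral_eq_lintegral_of_nonneg_ae (Filter.Eventually.of_forall fun w => by positivity)
    (by fun_prop), h1]
  refine ENNReal.toReal_pos ?_ ?_
  · rw [Ne, lintegral_eq_zero_iff (by fun_prop)]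
    intro hz
    have hz' : ∀ᵐ w ∂M.prior, w ∈ ({γ} : Set (Param d)) := by
      filter_upwards [hz] with w hw
      simp only [Pi.zero_apply, ENNReal.ofReal_eq_zero] at hw
      have : ‖γ - w‖ = 0 := by
        have := norm_nonneg (γ - w)
        nlinarith
      exact (sub_eq_zero.1 (norm_eq_zero.1 this)).symm
    have h2 : M.prior {γ} = 0 :=
      cond_absolutelyContinuous (hE.volume_singleton γ)
    have h3 := (prob_compl_eq_zero_iff (μ := M.prior) (measurableSet_singleton γ)).1 hz'
    rw [h2] at h3
    exact zero_ne_one h3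
  · refine ne_top_of_le_ne_top (b := ∫⁻ _w, ENNReal.ofReal ((2 * γbar) ^ 2) ∂M.prior) (by simp) ?_
    refine lintegral_mono_ae ?_
    filter_upwards [ae_mem_cond hE.measurableSet] with w hw
    have h1 := hE.norm_sub_le hγ hw
    rw [norm_sub_rev]
    gcongr

end Likelihood

section GoodEvent

/-- One factor of the average that bounds the likelihood from above. -/
noncomputable def upperFactor (M : Model d X A O) (γ : Param d)
    (Δ : X → A → Matrix (Fin d) (Fin d) ℝ) (Cσ : ℝ) (w : Param d) (r : Round X A O) : ℝ≥0∞ :=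
  ENNReal.ofReal (Real.exp ((-Cσ⁻¹) * logRatio M γ w r.1.1 r.1.2 r.2 +
    Cσ⁻¹ / 2 * sqNorm (Δ r.1.1 r.1.2) (γ - w)))

/-- One factor of the average that bounds the likelihood from below. -/
noncomputable def lowerFactor (M : Model d X A O) (γ : Param d) (CΓ Cσ : ℝ) (w : Param d)
    (r : Round X A O) : ℝ≥0∞ :=
  ENNReal.ofReal (Real.exp (Cσ⁻¹ * logRatio M γ w r.1.1 r.1.2 r.2 +
    -(3 / 2 * Cσ⁻¹ * CΓ * ‖w - γ‖ ^ 2)))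

/-- The sum of two likelihood-ratio averages over the prior. -/
noncomputable def ratioAverage (M : Model d X A O) (γ : Param d)
    (Δ : X → A → Matrix (Fin d) (Fin d) ℝ) (CΓ Cσ R : ℝ) {n : ℕ} (ω : Fin n → Round X A O) :
    ℝ≥0∞ :=
  ∫⁻ w, ∏ i, upperFactor M γ Δ Cσ w (ω i) ∂M.prior +
    ∫⁻ w, ∏ i, lowerFactor M γ CΓ Cσ (shrink γ R w) (ω i) ∂M.prior

theorem measurable_upperFactor (hO : ObservationModel M γ Δ Cσ CΓ) (s : ℝ) :
    Measurable fun p : Param d × Round X A O => upperFactor M γ Δ s p.1 p.2 := by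
  have h1 := M.measurable_logRatio_uncurry γ
  have h2 : Measurable fun p : Param d × Round X A O =>
      sqNorm (Δ p.2.1.1 p.2.1.2) (γ - p.1) := by
    simp_rw [sqNorm_eq_sum]
    refine Finset.measurable_sum _ fun i _ => Finset.measurable_sum _ fun j _ => ?_
    have h3 : Measurable fun p : Param d × Round X A O => Δ p.2.1.1 p.2.1.2 i j :=
      (hO.measurable i j).comp (f := fun p : Param d × Round X A O => p.2.1) (by fun_prop)
    have h4 : ∀ k, Measurable fun p : Param d × Round X A O => (γ - p.1).ofLp k := fun k =>
      (show Continuous fun w : Param d => (γ - w).ofLp k by fun_prop).measurable.comp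
        measurable_fst
    exact ((h4 i).mul h3).mul (h4 j)
  unfold upperFactor
  exact ((h1.const_mul _).add (h2.const_mul _)).exp.ennreal_ofReal

theorem measurable_lowerFactor (M : Model d X A O) (γ : Param d) (CΓ s : ℝ) :
    Measurable fun p : Param d × Round X A O => lowerFactor M γ CΓ s p.1 p.2 := by
  have h1 := M.measurable_logRatio_uncurry γ
  unfold lowerFactor
  exact ((h1.const_mul _).add (by fun_prop)).exp.ennreal_ofReal

theorem measurable_prod_factor {F : Param d → Round X A O → ℝ≥0∞}
    (hF : Measurable fun p : Param d × Round X A O => F p.1 p.2) (n : ℕ) :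
    Measurable fun p : (Fin n → Round X A O) × Param d => ∏ i, F p.2 (p.1 i) :=
  Finset.measurable_fun_prod _ fun i _ => hF.comp
    (f := fun p : (Fin n → Round X A O) × Param d => (p.2, p.1 i)) (by fun_prop)

theorem measurable_ratioAverage (hE : EnvironmentSpace M γbar rbar)
    (hO : ObservationModel M γ Δ Cσ CΓ) (s R : ℝ) (n : ℕ) :
    Measurable fun ω : Fin n → Round X A O => ratioAverage M γ Δ CΓ s R ω := by
  have := hE.isProbabilityMeasure_prior
  unfold ratioAverage
  refine Measurable.add (Measurable.lintegral_prod_right'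
    (measurable_prod_factor (measurable_upperFactor hO s) n)) ?_
  refine Measurable.lintegral_prod_right'
    (f := fun p : (Fin n → Round X A O) × Param d => ∏ i, lowerFactor M γ CΓ s
      (shrink γ R p.2) (p.1 i)) ?_
  exact (measurable_prod_factor (measurable_lowerFactor M γ CΓ s) n).comp
    (f := fun p : (Fin n → Round X A O) × Param d => (p.1, shrink γ R p.2))
    (measurable_fst.prodMk ((measurable_shrink γ R).comp measurable_snd))

theorem lintegral_average_le_one (hE : EnvironmentSpace M γbar rbar) (hγ : γ ∈ M.Γ)
    (f : Policy X A O) [∀ n, IsMarkovKernel (f n)] (n : ℕ) {F : Param d → Round X A O → ℝ≥0∞}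
    (hF : Measurable fun p : Param d × Round X A O => F p.1 p.2)
    (h : ∀ w ∈ M.Γ, ∀ x a, ∫⁻ o, F w ((x, a), o) ∂(M.obsLaw γ (x, a)) ≤ 1) :
    ∫⁻ ω, ∫⁻ w, ∏ i, F w (ω i) ∂M.prior ∂(M.roundsLaw γ f n) ≤ 1 := by
  have := hE.isProbabilityMeasure_prior
  have := M.isProbabilityMeasure_roundsLaw f hγ n
  -- After Tonelli each fixed parameter gives a product of mean at most one; the prior does not
  -- depend on the data.
  rw [lintegral_lintegral_swap (measurable_prod_factor hF n).aemeasurable]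
  calc _ ≤ ∫⁻ _w, 1 ∂M.prior := by
        refine lintegral_mono_ae ?_
        filter_upwards [ae_mem_cond hE.measurableSet] with w hw
        exact M.lintegral_prod_le_one f hγ
          (hF.comp (f := fun r => (w, r)) (by fun_prop)) (h w hw) n
    _ = 1 := by simp

theorem lintegral_ratioAverage_le (hE : EnvironmentSpace M γbar rbar)
    (hO : ObservationModel M γ Δ Cσ CΓ) (hγ : γ ∈ M.Γ) (hconv : Convex ℝ M.Γ)
    (f : Policy X A O) [∀ n, IsMarkovKernel (f n)] (n : ℕ) {R : ℝ} (hR : 1 ≤ R) :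
    ∫⁻ ω, ratioAverage M γ Δ CΓ Cσ R ω ∂(M.roundsLaw γ f n) ≤ 2 := by
  have := hE.isProbabilityMeasure_prior
  have h1 := lintegral_average_le_one hE hγ f n (measurable_upperFactor hO Cσ)
    (fun w hw x a => hO.lintegral_exp_upper_le_one hγ hw x a)
  have h2 := lintegral_average_le_one hE hγ f n
    (F := fun w => lowerFactor M γ CΓ Cσ (shrink γ R w))
    ((measurable_lowerFactor M γ CΓ Cσ).comp
      (f := fun p : Param d × Round X A O => (shrink γ R p.1, p.2))
      (((measurable_shrink γ R).comp measurable_fst).prodMk measurable_snd))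
    (fun w hw x a => hO.lintegral_exp_lower_le_one hγ (shrink_mem hconv hγ hR hw) x a)
  unfold ratioAverage
  rw [lintegral_add_left (Measurable.lintegral_prod_right'
    (measurable_prod_factor (measurable_upperFactor hO Cσ) n))]
  exact (add_le_add h1 h2).trans (by norm_num)

/-- The event on which the likelihood-ratio averages are large. -/
def badEvent (M : Model d X A O) (γ : Param d) (Δ : X → A → Matrix (Fin d) (Fin d) ℝ)
    (CΓ Cσ R : ℝ) (T n : ℕ) : Set (Fin n → Round X A O) :=
  {ω | ENNReal.ofReal (2 * T) ≤ ratioAverage M γ Δ CΓ Cσ R ω}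

/-- Markov's inequality at level `2T` for a sum of two averages, each of mean at most one. -/
theorem measure_badEvent_le (hE : EnvironmentSpace M γbar rbar)
    (hO : ObservationModel M γ Δ Cσ CΓ) (hγ : γ ∈ M.Γ) (hconv : Convex ℝ M.Γ)
    (f : Policy X A O) [∀ n, IsMarkovKernel (f n)] (n T : ℕ) {R : ℝ}
    (hR : 1 ≤ R) :
    M.roundsLaw γ f n (badEvent M γ Δ CΓ Cσ R T n) ≤ (T : ℝ≥0∞)⁻¹ := by
  have h1 := mul_meas_ge_le_lintegral (μ := M.roundsLaw γ f n)
    (measurable_ratioAverage hE hO Cσ R n) (ENNReal.ofReal (2 * T))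
  have h2 := h1.trans (lintegral_ratioAverage_le hE hO hγ hconv f n hR)
  have h3 : ENNReal.ofReal (2 * T) = 2 * (T : ℝ≥0∞) := by
    rw [ENNReal.ofReal_mul (by norm_num)]; simp
  rw [h3, mul_assoc] at h2
  have h4 : (T : ℝ≥0∞) * M.roundsLaw γ f n (badEvent M γ Δ CΓ Cσ R T n) ≤ 1 := by
    have : (2 : ℝ≥0∞) * ((T : ℝ≥0∞) * M.roundsLaw γ f n (badEvent M γ Δ CΓ Cσ R T n)) ≤ 2 * 1 := by
      rw [mul_one, badEvent, h3]; exact h2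
    exact (ENNReal.mul_le_mul_iff_right (by norm_num) (by norm_num)).1 this
  rw [ENNReal.le_inv_iff_mul_le, mul_comm]
  exact h4

/-- Posterior contraction outside of the bad event. -/
theorem posterior_secondMoment_le_of_good (hE : EnvironmentSpace M γbar rbar)
    (hO : ObservationModel M γ Δ Cσ CΓ) (hγ : γ ∈ M.Γ) (hconv : Convex ℝ M.Γ) {T n : ℕ}
    (hT : 1 ≤ T) (h : History X A O n) (hl : 0 < lam Δ h.1 n)
    (hgood : h.1 ∉ badEvent M γ Δ CΓ Cσ (invRadius γbar (CΓ * n)) T n) :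
    ∫ w, ‖γ - w‖ ^ 2 ∂(M.posterior h) ≤
      momentBound d T γbar CΓ Cσ (n + 1) (lam Δ h.1 n) := by
  have hprob := hE.isProbabilityMeasure_prior
  have hlC := lam_le hE hO hγ h.1
  have hCσ := two_le_variance_of_lam_pos hE hO hγ h.1 hl
  have hT0 : (1 : ℝ) ≤ T := by exact_mod_cast hT
  have hs : (0 : ℝ) ≤ (Cσ : ℝ)⁻¹ := by positivity
  rw [badEvent, Set.mem_ofPred_eq, not_le] at hgood
  have hA : ∫⁻ w, ∏ i, upperFactor M γ Δ Cσ w (h.1 i) ∂M.prior ≤ ENNReal.ofReal (2 * T) :=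
    le_self_add.trans hgood.le
  have hB : ∫⁻ w, ∏ i, lowerFactor M γ CΓ Cσ (shrink γ (invRadius γbar (CΓ * n)) w) (h.1 i)
      ∂M.prior ≤ ENNReal.ofReal (2 * T) := le_add_self.trans hgood.le
  refine le_trans (posterior_secondMoment_le hE hγ h
    (b := 16 / lam Δ h.1 n * tailExponent d T γbar (CΓ * n) Cσ) ?_ ?_)
    (tailExponent_le_momentBound hE.dim_pos hT hCσ hE.one_le hl hlC)
  · have := one_le_tailExponent (d := d) hT hCσ γbar (CΓ * n)
    positivity
  · have : IsProbabilityMeasure (ProbabilityTheory.cond (volume : Measure (Param d)) M.Γ) := hprob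
    refine secondMoment_le hE.measurableSet (fun y hy => hE.norm_sub_le hγ hy)
      (concaveOn_relLogLik hO hγ hconv h.1) hγ (measurable_relLogLik M γ h.1) hCσ hl hlC hT
      (le_trans (lintegral_mono fun w => ?_) hA) (le_trans (lintegral_mono fun w => ?_) hB)
    · simp only [upperFactor]
      rw [← ENNReal.ofReal_prod_of_nonneg (fun i _ => (Real.exp_pos _).le), ← Real.exp_sum,
        Finset.sum_add_distrib, ← Finset.mul_sum, ← Finset.mul_sum]
      refine ENNReal.ofReal_le_ofReal (Real.exp_le_exp.2 ?_)
      have h1 := lam_mul_le hE.dim_pos hO h.1 (γ - w)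
      rw [norm_sub_rev] at h1
      have h2 := mul_le_mul_of_nonneg_left h1 (show 0 ≤ (Cσ : ℝ)⁻¹ / 2 by positivity)
      rw [relLogLik, Finset.sum_neg_distrib]
      linarith
    · simp only [lowerFactor]
      rw [← ENNReal.ofReal_prod_of_nonneg (fun i _ => (Real.exp_pos _).le), ← Real.exp_sum,
        Finset.sum_add_distrib, ← Finset.mul_sum]
      refine ENNReal.ofReal_le_ofReal (Real.exp_le_exp.2 (le_of_eq ?_))
      rw [relLogLik, Finset.sum_neg_distrib]
      simp only [Finset.sum_const, Finset.card_univ, Fintype.card_fin, nsmul_eq_mul]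
      ring

end GoodEvent

end Posterior

/-! ### Reward gaps and the decomposition of the regret -/

section RegretDecomposition

variable {d : ℕ} {X A O : Type*} [MeasurableSpace X] [MeasurableSpace A] [MeasurableSpace O]
  {M : Model d X A O} {γ : Param d} {γbar rbar CΓ Cr ΔExploit : ℝ} {Cσ : ℝ≥0}
  {Δ : X → A → Matrix (Fin d) (Fin d) ℝ} {astar : Param d → X → A}

/-- The loss in mean reward of an action with respect to the optimal action. -/
noncomputable def rewardGap (M : Model d X A O) (astar : Param d → X → A) (γ : Param d)
    (q : X × A) : ℝ :=
  M.meanReward γ q.1 (astar γ q.1) - M.meanReward γ q.1 q.2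

section RewardGap

theorem measurable_meanReward (M : Model d X A O) (hγ : γ ∈ M.Γ) :
    Measurable fun q : X × A => M.meanReward γ q.1 q.2 := by
  have := M.isMarkovKernel_obsLaw hγ
  exact (StronglyMeasurable.integral_kernel_prod_right' (κ := M.obsLaw γ)
    (f := fun p : (X × A) × O => M.rew p.1.1 p.1.2 p.2)
    M.rew_measurable.stronglyMeasurable).measurable

theorem measurable_rewardGap (hopt : M.IsOptimalAction astar) (hγ : γ ∈ M.Γ) :
    Measurable (rewardGap M astar γ) := by
  have h1 : Measurable fun q : X × A => astar γ q.1 :=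
    hopt.measurable.comp (f := fun q : X × A => (γ, q.1)) (by fun_prop)
  exact ((measurable_meanReward M hγ).comp (f := fun q : X × A => (q.1, astar γ q.1))
    (measurable_fst.prodMk h1)).sub (measurable_meanReward M hγ)

theorem rewardGap_nonneg (hopt : M.IsOptimalAction astar) (hγ : γ ∈ M.Γ) (q : X × A) :
    0 ≤ rewardGap M astar γ q :=
  sub_nonneg.2 (hopt.optimal γ hγ q.1 q.2)

theorem rewardGap_le (hE : EnvironmentSpace M γbar rbar) (hγ : γ ∈ M.Γ) (q : X × A) :
    rewardGap M astar γ q ≤ rbar :=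
  hE.reward_le γ hγ _ _ _

/-- Only differences of mean rewards are bounded, not the mean rewards themselves, so expectations
over histories are always taken of gaps. -/
theorem integrable_rewardGap (hopt : M.IsOptimalAction astar) (hE : EnvironmentSpace M γbar rbar)
    (hγ : γ ∈ M.Γ) {Ω : Type*} [MeasurableSpace Ω] {μ : Measure Ω} [IsFiniteMeasure μ]
    {g : Ω → X × A} (hg : Measurable g) :
    Integrable (fun ω => rewardGap M astar γ (g ω)) μ := by
  refine Integrable.of_bound ((measurable_rewardGap hopt hγ).comp hg).aestronglyMeasurable rbar
    (Filter.Eventually.of_forall fun ω => ?_)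
  rw [Real.norm_of_nonneg (rewardGap_nonneg hopt hγ _)]
  exact rewardGap_le hE hγ _

/-- The conditional expectation of the reward gap given a history. -/
noncomputable def meanGap (M : Model d X A O) (astar : Param d → X → A) (γ : Param d)
    (f : Policy X A O) (n : ℕ) (h : History X A O n) : ℝ :=
  ∫ a, rewardGap M astar γ (h.2, a) ∂(f n h)

theorem meanGap_nonneg (f : Policy X A O) (hopt : M.IsOptimalAction astar) (hγ : γ ∈ M.Γ) (n : ℕ)
    (h : History X A O n) : 0 ≤ meanGap M astar γ f n h :=
  integral_nonneg fun _ => rewardGap_nonneg hopt hγ _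

variable (f : Policy X A O) [∀ n, IsMarkovKernel (f n)]

theorem meanGap_eq (hopt : M.IsOptimalAction astar) (hE : EnvironmentSpace M γbar rbar)
    (hγ : γ ∈ M.Γ) (n : ℕ) (h : History X A O n) :
    meanGap M astar γ f n h = M.meanReward γ h.2 (astar γ h.2) -
      ∫ a, M.meanReward γ h.2 a ∂(f n h) := by
  have h1 : Integrable (fun a => rewardGap M astar γ (h.2, a)) (f n h) :=
    integrable_rewardGap hopt hE hγ (by fun_prop)
  have h2 : Integrable (fun a => M.meanReward γ h.2 a) (f n h) := by
    refine ((integrable_const (M.meanReward γ h.2 (astar γ h.2))).sub h1).congr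
      (Filter.Eventually.of_forall fun a => ?_)
    simp [rewardGap]
  simp only [meanGap, rewardGap]
  rw [integral_sub (integrable_const _) h2]
  simp

theorem meanGap_le (hopt : M.IsOptimalAction astar) (hE : EnvironmentSpace M γbar rbar)
    (hγ : γ ∈ M.Γ) (n : ℕ) (h : History X A O n) : meanGap M astar γ f n h ≤ rbar := by
  calc meanGap M astar γ f n h ≤ ∫ _a, rbar ∂(f n h) :=
        integral_mono (integrable_rewardGap hopt hE hγ (by fun_prop)) (integrable_const _)
          fun a => rewardGap_le hE hγ _
    _ = rbar := by simp

theorem measurable_meanGap (hopt : M.IsOptimalAction astar) (hγ : γ ∈ M.Γ) (n : ℕ) :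
    Measurable (meanGap M astar γ f n) :=
  (StronglyMeasurable.integral_kernel_prod_right' (κ := f n)
    (f := fun p : History X A O n × A => rewardGap M astar γ (p.1.2, p.2))
    ((measurable_rewardGap hopt hγ).comp (f := fun p : History X A O n × A => (p.1.2, p.2))
      (by fun_prop)).stronglyMeasurable).measurable

theorem integrable_meanGap (hopt : M.IsOptimalAction astar) (hE : EnvironmentSpace M γbar rbar)
    (hγ : γ ∈ M.Γ) (n : ℕ) {μ : Measure (History X A O n)} [IsFiniteMeasure μ] :
    Integrable (meanGap M astar γ f n) μ := by
  refine Integrable.of_bound (measurable_meanGap f hopt hγ n).aestronglyMeasurable rbar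
    (Filter.Eventually.of_forall fun ω => ?_)
  rw [Real.norm_of_nonneg (meanGap_nonneg f hopt hγ n _)]
  exact meanGap_le f hopt hE hγ n _

theorem integral_rewardGap_round (hopt : M.IsOptimalAction astar)
    (hE : EnvironmentSpace M γbar rbar) (hγ : γ ∈ M.Γ) {T : ℕ} (t : Fin T) :
    ∫ ω, rewardGap M astar γ (ω t).1 ∂(M.roundsLaw γ f T) =
      ∫ h, meanGap M astar γ f t h ∂(M.historyLaw γ f t) := by
  have hm := measurable_rewardGap hopt hγ
  rw [integral_eq_lintegral_of_nonneg_ae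
      (Filter.Eventually.of_forall fun ω => rewardGap_nonneg hopt hγ _)
      (hm.comp (f := fun ω : Fin T → Round X A O => (ω t).1) (by fun_prop)).aestronglyMeasurable,
    integral_eq_lintegral_of_nonneg_ae
      (Filter.Eventually.of_forall fun h => meanGap_nonneg f hopt hγ t h)
      (measurable_meanGap f hopt hγ t).aestronglyMeasurable]
  congr 1
  refine (M.lintegral_roundsLaw_action f hγ t.2 hm.ennreal_ofReal).trans ?_
  refine lintegral_congr fun h => ?_
  rw [meanGap, ofReal_integral_eq_lintegral_ofReal (integrable_rewardGap hopt hE hγ (by fun_prop))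
    (Filter.Eventually.of_forall fun a => rewardGap_nonneg hopt hγ _)]

theorem regret_eq_sum (hopt : M.IsOptimalAction astar) (hE : EnvironmentSpace M γbar rbar)
    (hγ : γ ∈ M.Γ) (T : ℕ) : M.regret astar f γ T =
      ∑ t : Fin T, ∫ h, meanGap M astar γ f t h ∂(M.historyLaw γ f t) := by
  have := M.isProbabilityMeasure_roundsLaw f hγ T
  rw [Model.regret, integral_finsetSum]
  · exact Finset.sum_congr rfl fun t _ => integral_rewardGap_round f hopt hE hγ t
  · intro t _
    exact integrable_rewardGap hopt hE hγ (g := fun ω : Fin T → Round X A O => (ω t).1)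
      (by fun_prop)

end RewardGap

/-! ### Regret in terms of the minimum eigenvalues -/

section Regret

variable {algStar tf : Policy X A O} [∀ n, IsMarkovKernel (algStar n)]
  [∀ n, IsMarkovKernel (tf n)] {T : ℕ}

theorem regret_sub_le (hopt : M.IsOptimalAction astar) (hE : EnvironmentSpace M γbar rbar)
    (hγ : γ ∈ M.Γ) (hR : RewardGaps M γ astar algStar tf T ΔExploit Cr) :
    M.regret astar tf γ T - ΔExploit * T ≤
      ∑ t : Fin T, ∫ h, meanGap M astar γ algStar t h ∂(M.historyLaw γ tf t) := by
  have h1 : ∀ t : Fin T, ∫ h, meanGap M astar γ tf t h ∂(M.historyLaw γ tf t) ≤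
      ∫ h, meanGap M astar γ algStar t h ∂(M.historyLaw γ tf t) + ΔExploit := by
    intro t
    have := M.isProbabilityMeasure_historyLaw tf hγ t
    have h2 : ∫ h, meanGap M astar γ algStar t h ∂(M.historyLaw γ tf t) + ΔExploit =
        ∫ h, (meanGap M astar γ algStar t h + ΔExploit) ∂(M.historyLaw γ tf t) := by
      rw [integral_add (integrable_meanGap algStar hopt hE hγ t) (integrable_const _)]
      simp
    rw [h2]
    refine integral_mono_ae (integrable_meanGap tf hopt hE hγ t)
      ((integrable_meanGap algStar hopt hE hγ t).add (integrable_const _)) ?_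
    filter_upwards [hR.exploit t t.2] with h hh
    rw [meanGap_eq tf hopt hE hγ, meanGap_eq algStar hopt hE hγ]
    linarith
  rw [regret_eq_sum tf hopt hE hγ T]
  have h3 := Finset.sum_le_sum fun (t : Fin T) (_ : t ∈ Finset.univ) => h1 t
  rw [Finset.sum_add_distrib] at h3
  simp only [Finset.sum_const, Finset.card_univ, Fintype.card_fin, nsmul_eq_mul] at h3
  linarith

/-- At the empty history the posterior is the prior, whose second moment about `γ` is positive,
while the gap of the optimal action is nonnegative. -/
theorem posteriorConstant_nonneg (hT : 1 ≤ T) (hopt : M.IsOptimalAction astar)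
    (hE : EnvironmentSpace M γbar rbar) (hγ : γ ∈ M.Γ)
    (hR : RewardGaps M γ astar algStar tf T ΔExploit Cr) : 0 ≤ Cr := by
  have := M.isProbabilityMeasure_historyLaw tf hγ 0
  obtain ⟨h, hh⟩ := (hR.posterior_gap 0 hT).exists
  have h1 := meanGap_nonneg algStar hopt hγ 0 h
  rw [meanGap_eq algStar hopt hE hγ] at h1
  exact nonneg_of_mul_nonneg_left (h1.trans hh) (posterior_secondMoment_pos hE hγ h)

theorem rewardRange_nonneg (hopt : M.IsOptimalAction astar)
    (hE : EnvironmentSpace M γbar rbar) (hγ : γ ∈ M.Γ) : 0 ≤ rbar := by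
  have := M.isProbabilityMeasure_ctxLaw hγ
  obtain ⟨x⟩ := nonempty_of_isProbabilityMeasure (M.ctxLaw γ)
  exact (rewardGap_nonneg hopt hγ (x, astar γ x)).trans (rewardGap_le hE hγ _)

/-- The function `H` is left free so that one argument serves both bounds of the theorem. The
minimum in `hhigh` allows the trivial bound `rbar` even when `l > 0`, which the second bound needs
for small `l`. -/
theorem lintegral_meanGap_le (hT : 1 ≤ T) (hopt : M.IsOptimalAction astar)
    (hE : EnvironmentSpace M γbar rbar) (hO : ObservationModel M γ Δ Cσ CΓ) (hγ : γ ∈ M.Γ)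
    (hR : RewardGaps M γ astar algStar tf T ΔExploit Cr) {n : ℕ} (hn : n < T)
    {H : ℝ → ℝ≥0∞} (hH : Measurable H) (hlow : ∀ l ≤ 0, ENNReal.ofReal rbar ≤ H l)
    (hhigh : ∀ l, 0 < l → l ≤ CΓ * n →
      min (ENNReal.ofReal rbar) (ENNReal.ofReal (Cr * momentBound d T γbar CΓ Cσ (n + 1) l)) ≤
        H l) :
    ∫⁻ h, ENNReal.ofReal (meanGap M astar γ algStar n h) ∂(M.historyLaw γ tf n) ≤
      ∫⁻ ω, H (lam Δ ω n) ∂(M.roundsLaw γ tf T) +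
        ENNReal.ofReal (4 * Cr * γbar ^ 2) * (T : ℝ≥0∞)⁻¹ := by
  have hCr := posteriorConstant_nonneg hT hopt hE hγ hR
  have hconv : Convex ℝ M.Γ := by
    have := M.isProbabilityMeasure_ctxLaw hγ
    obtain ⟨x⟩ := nonempty_of_isProbabilityMeasure (M.ctxLaw γ)
    exact hO.convex hγ x (astar γ x)
  set B := badEvent M γ Δ CΓ Cσ (invRadius γbar (CΓ * n)) T n with hB
  have hBm : MeasurableSet B :=
    measurableSet_le measurable_const (measurable_ratioAverage hE hO Cσ _ n)
  have hHm : Measurable fun ω : Fin n → Round X A O => H (lam Δ ω n) :=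
    hH.comp (measurable_lam hE.dim_pos hO n n)
  have hpt : ∀ᵐ h ∂(M.historyLaw γ tf n),
      ENNReal.ofReal (meanGap M astar γ algStar n h) ≤
        H (lam Δ h.1 n) + B.indicator (fun _ => ENNReal.ofReal (4 * Cr * γbar ^ 2)) h.1 := by
    filter_upwards [hR.posterior_gap n hn] with h hh
    rw [← meanGap_eq algStar hopt hE hγ] at hh
    have hrange := meanGap_le algStar hopt hE hγ n h
    by_cases hb : h.1 ∈ B
    · rw [Set.indicator_of_mem hb]
      refine le_add_left (ENNReal.ofReal_le_ofReal (hh.trans ?_))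
      have := mul_le_mul_of_nonneg_left (posterior_secondMoment_le_const hE hγ h) hCr
      linarith
    · refine le_add_right ?_
      rcases le_or_gt (lam Δ h.1 n) 0 with hl | hl
      · exact (ENNReal.ofReal_le_ofReal hrange).trans (hlow _ hl)
      · refine le_trans (le_min (ENNReal.ofReal_le_ofReal hrange)
          (ENNReal.ofReal_le_ofReal (hh.trans ?_))) (hhigh _ hl (lam_le hE hO hγ h.1))
        exact mul_le_mul_of_nonneg_left
          (posterior_secondMoment_le_of_good hE hO hγ hconv hT h hl hb) hCr
  calc _ ≤ ∫⁻ h, (H (lam Δ h.1 n) +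
        B.indicator (fun _ => ENNReal.ofReal (4 * Cr * γbar ^ 2)) h.1) ∂(M.historyLaw γ tf n) :=
        lintegral_mono_ae hpt
    _ = ∫⁻ ω, (H (lam Δ ω n) +
        B.indicator (fun _ => ENNReal.ofReal (4 * Cr * γbar ^ 2)) ω) ∂(M.roundsLaw γ tf n) := by
        rw [← M.map_fst_historyLaw tf hγ n, lintegral_map
          (hHm.fun_add (measurable_const.indicator hBm)) measurable_fst]
    _ = ∫⁻ ω, H (lam Δ ω n) ∂(M.roundsLaw γ tf n) +
        ENNReal.ofReal (4 * Cr * γbar ^ 2) * M.roundsLaw γ tf n B := by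
        rw [lintegral_add_left hHm, lintegral_indicator_const hBm]
    _ ≤ ∫⁻ ω, H (lam Δ ω n) ∂(M.roundsLaw γ tf n) +
        ENNReal.ofReal (4 * Cr * γbar ^ 2) * (T : ℝ≥0∞)⁻¹ := by
        gcongr
        exact measure_badEvent_le hE hO hγ hconv tf n T (one_le_invRadius _ _)
    _ = _ := by
        rw [← M.map_castLE_roundsLaw tf hγ hn.le, lintegral_map hHm (by fun_prop)]
        simp_rw [lam_castLE]

/-- The regret is bounded by expected functions of the minimum eigenvalues. -/
theorem regret_le_lintegral (hT : 1 ≤ T) (hopt : M.IsOptimalAction astar)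
    (hE : EnvironmentSpace M γbar rbar) (hO : ObservationModel M γ Δ Cσ CΓ) (hγ : γ ∈ M.Γ)
    (hR : RewardGaps M γ astar algStar tf T ΔExploit Cr)
    {H : ℕ → ℝ → ℝ≥0∞} (hH : ∀ n, Measurable (H n))
    (hlow : ∀ n, ∀ l ≤ 0, ENNReal.ofReal rbar ≤ H n l)
    (hhigh : ∀ n < T, ∀ l, 0 < l → l ≤ CΓ * n →
      min (ENNReal.ofReal rbar) (ENNReal.ofReal (Cr * momentBound d T γbar CΓ Cσ (n + 1) l)) ≤
        H n l) :
    ENNReal.ofReal (M.regret astar tf γ T - ΔExploit * T) ≤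
      ∫⁻ ω, ∑ n ∈ Finset.range T, H n (lam Δ ω n) ∂(M.roundsLaw γ tf T) +
        ENNReal.ofReal (4 * Cr * γbar ^ 2) := by
  have h1 : ∀ t : Fin T, ENNReal.ofReal (∫ h, meanGap M astar γ algStar t h
      ∂(M.historyLaw γ tf t)) ≤ ∫⁻ ω, H t (lam Δ ω t) ∂(M.roundsLaw γ tf T) +
        ENNReal.ofReal (4 * Cr * γbar ^ 2) * (T : ℝ≥0∞)⁻¹ := fun t => by
    have := M.isProbabilityMeasure_historyLaw tf hγ t
    rw [ofReal_integral_eq_lintegral_ofReal (integrable_meanGap algStar hopt hE hγ t)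
      (Filter.Eventually.of_forall fun h => meanGap_nonneg algStar hopt hγ t h)]
    exact lintegral_meanGap_le hT hopt hE hO hγ hR t.2 (hH t) (hlow t) (hhigh t t.2)
  have hT0 : (T : ℝ≥0∞) ≠ 0 := by
    simp only [ne_eq, Nat.cast_eq_zero]; omega
  calc _ ≤ ENNReal.ofReal (∑ t : Fin T, ∫ h, meanGap M astar γ algStar t h
        ∂(M.historyLaw γ tf t)) := ENNReal.ofReal_le_ofReal (regret_sub_le hopt hE hγ hR)
    _ = ∑ t : Fin T, ENNReal.ofReal (∫ h, meanGap M astar γ algStar t h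
        ∂(M.historyLaw γ tf t)) := ENNReal.ofReal_sum_of_nonneg fun t _ =>
          integral_nonneg fun h => meanGap_nonneg algStar hopt hγ t h
    _ ≤ ∑ t : Fin T, (∫⁻ ω, H t (lam Δ ω t) ∂(M.roundsLaw γ tf T) +
        ENNReal.ofReal (4 * Cr * γbar ^ 2) * (T : ℝ≥0∞)⁻¹) := Finset.sum_le_sum fun t _ => h1 t
    _ = _ := by
        have hm : ∀ n ∈ Finset.range T, Measurable fun ω : Fin T → Round X A O =>
            H n (lam Δ ω n) := fun n _ => (hH n).comp (measurable_lam hE.dim_pos hO T n)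
        rw [Finset.sum_add_distrib, lintegral_finsetSum _ hm,
          Finset.sum_range (fun n => ∫⁻ ω, H n (lam Δ ω n) ∂(M.roundsLaw γ tf T))]
        congr 1
        simp only [Finset.sum_const, Finset.card_univ, Fintype.card_fin, nsmul_eq_mul]
        rw [mul_left_comm, ENNReal.mul_inv_cancel hT0 (ENNReal.natCast_ne_top T), mul_one]

end Regret

/-! ### The time `tZero` as a count of rounds -/

section StoppingTime

theorem tZero_mem {T : ℕ} (ω : Fin T → Round X A O) :
    tZero Δ ω ∈ {t | 2 ≤ t ∧ t ≤ T ∧ 0 < lam Δ ω (t - 1)} ∪ {T + 1} :=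
  Nat.sInf_mem ⟨T + 1, Or.inr rfl⟩

theorem two_le_tZero {T : ℕ} (hT : 1 ≤ T) (ω : Fin T → Round X A O) : 2 ≤ tZero Δ ω := by
  rcases tZero_mem (Δ := Δ) ω with h | h
  · exact h.1
  · rw [Set.mem_singleton_iff] at h; omega

theorem tZero_le {T : ℕ} (ω : Fin T → Round X A O) : tZero Δ ω ≤ T + 1 :=
  Nat.sInf_le (Or.inr rfl)

/-- Monotonicity of `lam` makes positivity persist after `tZero`. The index `n` of completed rounds
corresponds to `t = n + 1`, and at `n = 0` the empty sum has `lam ≤ 0`, in agreement with `2 ≤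
tZero`. -/
theorem lam_nonpos_iff (hd : 0 < d) (hO : ObservationModel M γ Δ Cσ CΓ) {T n : ℕ}
    (ω : Fin T → Round X A O) (hn : n < T) : lam Δ ω n ≤ 0 ↔ n + 1 < tZero Δ ω := by
  constructor
  · intro h
    by_contra hlt
    rcases tZero_mem (Δ := Δ) ω with h1 | h1
    · have := lam_mono hd hO ω (show tZero Δ ω - 1 ≤ n by omega)
      linarith [h1.2.2]
    · rw [Set.mem_singleton_iff] at h1; omega
  · intro h
    rcases Nat.eq_zero_or_pos n with rfl | h0
    · exact lam_zero_le hd ω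
    · by_contra hl
      have : tZero Δ ω ≤ n + 1 := Nat.sInf_le (Or.inl ⟨by omega, by omega, by simpa using hl⟩)
      omega

theorem tZero_sub_one (hd : 0 < d) (hO : ObservationModel M γ Δ Cσ CΓ) {T : ℕ} (hT : 1 ≤ T)
    (ω : Fin T → Round X A O) : (tZero Δ ω : ℝ) - 1 =
      ∑ n ∈ Finset.range T, if lam Δ ω n ≤ 0 then 1 else 0 := by
  rw [← Finset.sum_filter]
  have h1 := two_le_tZero (Δ := Δ) hT ω
  have h2 := tZero_le (Δ := Δ) ω
  have h3 : (Finset.range T).filter (fun n => lam Δ ω n ≤ 0) = Finset.range (tZero Δ ω - 1) := by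
    ext n
    simp only [Finset.mem_filter, Finset.mem_range]
    constructor
    · rintro ⟨hn, hl⟩
      rw [lam_nonpos_iff hd hO ω hn] at hl
      omega
    · intro hn
      have hn' : n < T := by omega
      exact ⟨hn', (lam_nonpos_iff hd hO ω hn').2 (by omega)⟩
  rw [h3]
  simp only [Finset.sum_const, Finset.card_range, nsmul_eq_mul, mul_one]
  rw [Nat.cast_sub (by omega)]
  simp

theorem sum_Icc_tZero (hd : 0 < d) (hO : ObservationModel M γ Δ Cσ CΓ) {T : ℕ} (hT : 1 ≤ T)
    (ω : Fin T → Round X A O) (F : ℕ → ℝ → ℝ) :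
    ∑ t ∈ Finset.Icc (tZero Δ ω) T, F t (lam Δ ω (t - 1)) =
      ∑ n ∈ Finset.range T, if lam Δ ω n ≤ 0 then 0 else F (n + 1) (lam Δ ω n) := by
  simp_rw [← ite_not (p := lam Δ ω _ ≤ 0)]
  rw [← Finset.sum_filter]
  have h1 := two_le_tZero (Δ := Δ) hT ω
  refine Finset.sum_nbij' (fun t => t - 1) (fun n => n + 1) ?_ ?_ ?_ ?_ ?_
  · intro t ht
    rw [Finset.mem_Icc] at ht
    have hn : t - 1 < T := by omega
    simp only [Finset.mem_filter, Finset.mem_range, lam_nonpos_iff hd hO ω hn]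
    omega
  · intro n hn
    rw [Finset.mem_filter, Finset.mem_range] at hn
    rw [lam_nonpos_iff hd hO ω hn.1] at hn
    rw [Finset.mem_Icc]
    omega
  · intro t ht
    rw [Finset.mem_Icc] at ht
    omega
  · intro n _; simp
  · intro t ht
    rw [Finset.mem_Icc] at ht
    rw [Nat.sub_add_cancel (by omega)]

end StoppingTime

end RegretDecomposition

/-! ### Assembly of the two bounds in `EReal` -/

section Assembly

variable {d : ℕ} {X A O : Type*} [MeasurableSpace X] [MeasurableSpace A] [MeasurableSpace O]
  {M : Model d X A O} {γ : Param d} {γbar rbar CΓ Cr ΔExploit : ℝ} {Cσ : ℝ≥0}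
  {Δ : X → A → Matrix (Fin d) (Fin d) ℝ} {astar : Param d → X → A} {T : ℕ}

theorem coe_le_add_of_ofReal_sub_le {x a : ℝ} {e : ℝ≥0∞} (h : ENNReal.ofReal (x - a) ≤ e) :
    (x : EReal) ≤ (a : EReal) + (e : EReal) := by
  have h1 : ((x - a : ℝ) : EReal) ≤ (e : EReal) := by
    refine le_trans ?_ (EReal.coe_ennreal_le_coe_ennreal_iff.2 h)
    rw [EReal.coe_ennreal_ofReal]
    exact EReal.coe_le_coe_iff.2 (le_max_left _ _)
  calc (x : EReal) = (a : EReal) + ((x - a : ℝ) : EReal) := by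
        rw [← EReal.coe_add]; simp
    _ ≤ _ := add_le_add_right h1 _

theorem coe_mul_expect {c : ℝ} (hc : 0 ≤ c) {Ω : Type*} [MeasurableSpace Ω] (μ : Measure Ω)
    (f : Ω → ℝ) : (c : EReal) * expect μ f =
      ((ENNReal.ofReal c * ∫⁻ ω, ENNReal.ofReal (f ω) ∂μ : ℝ≥0∞) : EReal) := by
  rw [EReal.coe_ennreal_mul, EReal.coe_ennreal_ofReal, max_eq_left hc, expect]

theorem lam_le_mul (hE : EnvironmentSpace M γbar rbar) (hO : ObservationModel M γ Δ Cσ CΓ)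
    (hγ : γ ∈ M.Γ) (ω : Fin T → Round X A O) {n : ℕ} (hn : n ≤ T) : lam Δ ω n ≤ CΓ * n := by
  rw [← lam_castLE hn]
  exact lam_le hE hO hγ _

theorem sum_ofReal_Icc_tZero (hT : 1 ≤ T) (hE : EnvironmentSpace M γbar rbar)
    (hO : ObservationModel M γ Δ Cσ CΓ) (hγ : γ ∈ M.Γ) {F : ℕ → ℝ → ℝ}
    (hF : ∀ (n : ℕ) (l : ℝ), 0 < l → l ≤ CΓ * n → 0 ≤ F (n + 1) l) (ω : Fin T → Round X A O) :
    ∑ n ∈ Finset.range T, ENNReal.ofReal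
        (if lam Δ ω n ≤ 0 then 0 else F (n + 1) (lam Δ ω n)) =
      ENNReal.ofReal (∑ t ∈ Finset.Icc (tZero Δ ω) T, F t (lam Δ ω (t - 1))) := by
  rw [sum_Icc_tZero hE.dim_pos hO hT ω F, ENNReal.ofReal_sum_of_nonneg]
  intro n hn
  split_ifs with h
  · exact le_rfl
  · exact hF n _ (not_le.1 h) (lam_le_mul hE hO hγ ω (Finset.mem_range.1 hn).le)

theorem measurable_sum_Icc_tZero (hT : 1 ≤ T) (hE : EnvironmentSpace M γbar rbar)
    (hO : ObservationModel M γ Δ Cσ CΓ) {F : ℕ → ℝ → ℝ} (hF : ∀ t, Measurable (F t)) :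
    Measurable fun ω : Fin T → Round X A O =>
      ∑ t ∈ Finset.Icc (tZero Δ ω) T, F t (lam Δ ω (t - 1)) := by
  simp_rw [sum_Icc_tZero hE.dim_pos hO hT]
  refine Finset.measurable_sum _ fun n _ => ?_
  have hl := measurable_lam hE.dim_pos hO T n
  exact Measurable.ite (measurableSet_le hl measurable_const) measurable_const ((hF _).comp hl)

theorem sum_ofReal_tZero (hT : 1 ≤ T) (hE : EnvironmentSpace M γbar rbar)
    (hO : ObservationModel M γ Δ Cσ CΓ) (ω : Fin T → Round X A O) :
    ∑ n ∈ Finset.range T, ENNReal.ofReal (if lam Δ ω n ≤ 0 then 1 else 0) =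
      ENNReal.ofReal ((tZero Δ ω : ℝ) - 1) := by
  rw [tZero_sub_one hE.dim_pos hO hT ω, ENNReal.ofReal_sum_of_nonneg]
  intro n _
  split_ifs <;> norm_num

theorem measurable_tZero_sub_one (hT : 1 ≤ T) (hE : EnvironmentSpace M γbar rbar)
    (hO : ObservationModel M γ Δ Cσ CΓ) :
    Measurable fun ω : Fin T → Round X A O => (tZero Δ ω : ℝ) - 1 := by
  simp_rw [tZero_sub_one hE.dim_pos hO hT]
  refine Finset.measurable_sum _ fun n _ => ?_
  exact Measurable.ite (measurableSet_le (measurable_lam hE.dim_pos hO T n) measurable_const)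
    measurable_const measurable_const

theorem measurable_epsT (d : ℕ) (γbar CΓ : ℝ) (t : ℕ) : Measurable (epsT d γbar CΓ t) := by
  unfold epsT coverRatio
  fun_prop

theorem measurable_coverT (d : ℕ) (γbar CΓ : ℝ) (t : ℕ) : Measurable (coverT d γbar CΓ t) := by
  have := measurable_epsT d γbar CΓ t
  unfold coverT
  fun_prop

theorem logCover_div_nonneg (hT : 1 ≤ T) {t : ℕ} {l : ℝ} (hl : 0 < l) :
    0 ≤ Real.log (2 * coverT d γbar CΓ t l * T) / l := by
  have h1 : (1 : ℝ) ≤ coverT d γbar CΓ t l := le_max_left _ _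
  have h2 : (1 : ℝ) ≤ T := by exact_mod_cast hT
  exact div_nonneg (Real.log_nonneg (by nlinarith)) hl.le

variable {algStar tf : Policy X A O} [∀ n, IsMarkovKernel (algStar n)]
  [∀ n, IsMarkovKernel (tf n)]

theorem regret_le_explicit (hT : 1 ≤ T) (hopt : M.IsOptimalAction astar)
    (hE : EnvironmentSpace M γbar rbar) (hO : ObservationModel M γ Δ Cσ CΓ) (hγ : γ ∈ M.Γ)
    (hR : RewardGaps M γ astar algStar tf T ΔExploit Cr) :
    ((M.regret astar tf γ T : ℝ) : EReal) ≤
      ((ΔExploit * T : ℝ) : EReal)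
      + (rbar : EReal) * expect (M.roundsLaw γ tf T) (fun ω => (tZero Δ ω : ℝ) - 1)
      + (Cr : EReal) * expect (M.roundsLaw γ tf T)
          (fun ω => ∑ t ∈ Finset.Icc (tZero Δ ω) T, epsT d γbar CΓ t (lam Δ ω (t - 1)))
      + ((16 * Cr * (4 * Cσ + 1) : ℝ) : EReal) * expect (M.roundsLaw γ tf T)
          (fun ω => ∑ t ∈ Finset.Icc (tZero Δ ω) T,
            Real.log (2 * coverT d γbar CΓ t (lam Δ ω (t - 1)) * T) / lam Δ ω (t - 1))
      + ((4 * Cr * γbar ^ 2 : ℝ) : EReal) := by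
  have hCr := posteriorConstant_nonneg hT hopt hE hγ hR
  have hrbar := rewardRange_nonneg hopt hE hγ
  have hc : 0 ≤ 16 * Cr * (4 * (Cσ : ℝ) + 1) := by positivity
  set F₁ : ℕ → ℝ → ℝ := fun t l => epsT d γbar CΓ t l with hF₁
  set F₂ : ℕ → ℝ → ℝ := fun t l => Real.log (2 * coverT d γbar CΓ t l * T) / l with hF₂
  have hm₁ : ∀ t, Measurable (F₁ t) := fun t => measurable_epsT d γbar CΓ t
  have hm₂ : ∀ t, Measurable (F₂ t) := fun t => by
    have := measurable_coverT d γbar CΓ t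
    simp only [hF₂]
    fun_prop
  have hn₁ : ∀ (n : ℕ) (l : ℝ), 0 < l → l ≤ CΓ * n → 0 ≤ F₁ (n + 1) l := fun n l hl hlC =>
    (epsT_pos hE.dim_pos hE.one_le hl hlC).le
  have hn₂ : ∀ (n : ℕ) (l : ℝ), 0 < l → l ≤ CΓ * n → 0 ≤ F₂ (n + 1) l := fun n l hl _ =>
    logCover_div_nonneg hT hl
  have hset : MeasurableSet {l : ℝ | l ≤ 0} := measurableSet_Iic
  have key := regret_le_lintegral hT hopt hE hO hγ hR
    -- The first summand counts rounds before `tZero`; the other two are the parts of `Cr *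
    -- momentBound`.
    (H := fun n l => ENNReal.ofReal rbar * ENNReal.ofReal (if l ≤ 0 then 1 else 0) +
      (ENNReal.ofReal Cr * ENNReal.ofReal (if l ≤ 0 then 0 else F₁ (n + 1) l) +
        ENNReal.ofReal (16 * Cr * (4 * (Cσ : ℝ) + 1)) *
          ENNReal.ofReal (if l ≤ 0 then 0 else F₂ (n + 1) l)))
    (fun n => by
      have e0 : Measurable fun l : ℝ => if l ≤ 0 then (1 : ℝ) else 0 :=
        Measurable.ite hset measurable_const measurable_const
      have e1 : Measurable fun l : ℝ => if l ≤ 0 then 0 else F₁ (n + 1) l :=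
        Measurable.ite hset measurable_const (hm₁ _)
      have e2 : Measurable fun l : ℝ => if l ≤ 0 then 0 else F₂ (n + 1) l :=
        Measurable.ite hset measurable_const (hm₂ _)
      exact (e0.ennreal_ofReal.const_mul _).add
        ((e1.ennreal_ofReal.const_mul _).add (e2.ennreal_ofReal.const_mul _)))
    (fun n l hl => by simp [hl])
    (fun n _ l hl hlC => by
      refine (min_le_right _ _).trans (le_of_eq ?_)
      have h0 : ¬ l ≤ 0 := not_le.2 hl
      simp only [if_neg h0, ENNReal.ofReal_zero, mul_zero, zero_add]
      rw [← ENNReal.ofReal_mul hCr, ← ENNReal.ofReal_mul hc,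
        ← ENNReal.ofReal_add (mul_nonneg hCr (hn₁ n l hl hlC)) (mul_nonneg hc (hn₂ n l hl hlC))]
      congr 1
      rw [momentBound]
      ring)
  have hsum : ∀ ω : Fin T → Round X A O, ∑ n ∈ Finset.range T,
      (ENNReal.ofReal rbar * ENNReal.ofReal (if lam Δ ω n ≤ 0 then 1 else 0) +
      (ENNReal.ofReal Cr * ENNReal.ofReal (if lam Δ ω n ≤ 0 then 0 else F₁ (n + 1) (lam Δ ω n)) +
        ENNReal.ofReal (16 * Cr * (4 * (Cσ : ℝ) + 1)) *
          ENNReal.ofReal (if lam Δ ω n ≤ 0 then 0 else F₂ (n + 1) (lam Δ ω n)))) =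
      ENNReal.ofReal rbar * ENNReal.ofReal ((tZero Δ ω : ℝ) - 1) +
      (ENNReal.ofReal Cr * ENNReal.ofReal
          (∑ t ∈ Finset.Icc (tZero Δ ω) T, F₁ t (lam Δ ω (t - 1))) +
        ENNReal.ofReal (16 * Cr * (4 * (Cσ : ℝ) + 1)) * ENNReal.ofReal
          (∑ t ∈ Finset.Icc (tZero Δ ω) T, F₂ t (lam Δ ω (t - 1)))) := fun ω => by
    rw [Finset.sum_add_distrib, Finset.sum_add_distrib, ← Finset.mul_sum, ← Finset.mul_sum,
      ← Finset.mul_sum, sum_ofReal_tZero hT hE hO, sum_ofReal_Icc_tZero hT hE hO hγ hn₁,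
      sum_ofReal_Icc_tZero hT hE hO hγ hn₂]
  simp_rw [hsum] at key
  have hM₀ := measurable_tZero_sub_one hT hE hO
  have hM₁ := measurable_sum_Icc_tZero hT hE hO hm₁
  have hM₂ := measurable_sum_Icc_tZero hT hE hO hm₂
  rw [lintegral_add_left (hM₀.ennreal_ofReal.const_mul _),
    lintegral_add_left (hM₁.ennreal_ofReal.const_mul _),
    lintegral_const_mul' _ _ ENNReal.ofReal_ne_top, lintegral_const_mul' _ _ ENNReal.ofReal_ne_top,
    lintegral_const_mul' _ _ ENNReal.ofReal_ne_top] at key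
  refine (coe_le_add_of_ofReal_sub_le key).trans (le_of_eq ?_)
  have h4 : 0 ≤ 4 * Cr * γbar ^ 2 := by positivity
  rw [coe_mul_expect hrbar, coe_mul_expect hCr, coe_mul_expect hc, EReal.coe_ennreal_add,
    EReal.coe_ennreal_add, EReal.coe_ennreal_add, EReal.coe_ennreal_ofReal, max_eq_left h4]
  simp only [add_assoc]
  rfl

/-- The constant in front of the logarithmic factor. -/
noncomputable def baseConstant (γbar rbar Cr CΓ Cσ : ℝ) : ℝ :=
  |rbar| / Real.log 2 +
    |Cr| * (16 * ((4 * Cσ + 2) * (|Real.log (64 * γbar * CΓ)| / Real.log 2 + 1) + (4 * Cσ + 1)))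

/-- The constant of the order-wise regret bound. -/
noncomputable def regretConstant (γbar rbar Cr CΓ Cσ : ℝ) : ℝ :=
  baseConstant γbar rbar Cr CΓ Cσ + 4 * |Cr| * γbar ^ 2 / Real.log 2 + 1

theorem baseConstant_nonneg (γbar rbar Cr CΓ : ℝ) (Cσ : ℝ≥0) :
    0 ≤ baseConstant γbar rbar Cr CΓ Cσ := by
  have := Real.log_pos one_lt_two
  unfold baseConstant
  positivity

theorem regretConstant_pos (γbar rbar Cr CΓ : ℝ) (Cσ : ℝ≥0) :
    0 < regretConstant γbar rbar Cr CΓ Cσ := by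
  have := Real.log_pos one_lt_two
  have := baseConstant_nonneg γbar rbar Cr CΓ Cσ
  unfold regretConstant
  positivity

theorem regret_le_order (hT : 1 ≤ T) (hCΓ : 0 < CΓ) (hopt : M.IsOptimalAction astar)
    (hE : EnvironmentSpace M γbar rbar) (hO : ObservationModel M γ Δ Cσ CΓ) (hγ : γ ∈ M.Γ)
    (hR : RewardGaps M γ astar algStar tf T ΔExploit Cr) :
    ((M.regret astar tf γ T : ℝ) : EReal) ≤
      ((ΔExploit * T : ℝ) : EReal)
      + ((regretConstant γbar rbar Cr CΓ Cσ * Real.log (2 * d * T) : ℝ) : EReal) *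
          expect (M.roundsLaw γ tf T) (fun ω => (tZero Δ ω : ℝ) +
            ∑ t ∈ Finset.Icc (tZero Δ ω) T, (d : ℝ) / lam Δ ω (t - 1)) := by
  have hprob := M.isProbabilityMeasure_roundsLaw tf hγ T
  have hCr := posteriorConstant_nonneg hT hopt hE hγ hR
  have hrbar := rewardRange_nonneg hopt hE hγ
  have hd' : (1 : ℝ) ≤ d := by exact_mod_cast hE.dim_pos
  have hT' : (1 : ℝ) ≤ T := by exact_mod_cast hT
  have hlog2 := Real.log_pos one_lt_two
  have hD : Real.log 2 ≤ Real.log (2 * d * T) := Real.log_le_log (by norm_num) (by nlinarith)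
  set D := Real.log (2 * d * T) with hDdef
  set a := |Real.log (64 * γbar * CΓ)| / Real.log 2 with ha
  have ha0 : 0 ≤ a := by positivity
  set b := baseConstant γbar rbar Cr CΓ Cσ with hb
  have hb0 : 0 ≤ b := baseConstant_nonneg γbar rbar Cr CΓ Cσ
  have hbD0 : 0 ≤ b * D := mul_nonneg hb0 (by linarith)
  have hD0 : 0 ≤ D := by linarith
  have hdiv : ∀ y, 0 ≤ y → y ≤ y / Real.log 2 * D := fun y hy => by
    rw [div_mul_eq_mul_div, le_div_iff₀ hlog2]
    exact mul_le_mul_of_nonneg_left hD hy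
  have hbeq : b = rbar / Real.log 2 +
      Cr * (16 * ((4 * Cσ + 2) * (a + 1) + (4 * Cσ + 1))) := by
    rw [hb, baseConstant, abs_of_nonneg hrbar, abs_of_nonneg hCr]
  have hb1 : rbar ≤ b * D := by
    have h1 : 0 ≤ Cr * (16 * ((4 * (Cσ : ℝ) + 2) * (a + 1) + (4 * Cσ + 1))) * D := by positivity
    rw [hbeq, add_mul]
    linarith [hdiv rbar hrbar]
  have hb2 : Cr * (16 * ((4 * Cσ + 2) * (a + 1) + (4 * Cσ + 1))) * D ≤ b * D := by
    have : 0 ≤ rbar / Real.log 2 * D := by positivity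
    rw [hbeq, add_mul]
    linarith
  set F : ℕ → ℝ → ℝ := fun _ l => (d : ℝ) / l with hF
  have hm : ∀ t, Measurable (F t) := fun t => by simp only [hF]; fun_prop
  have hn : ∀ (n : ℕ) (l : ℝ), 0 < l → l ≤ CΓ * n → 0 ≤ F (n + 1) l := fun n l hl _ => by
    simp only [hF]; positivity
  have hset : MeasurableSet {l : ℝ | l ≤ 0} := measurableSet_Iic
  have key := regret_le_lintegral hT hopt hE hO hγ hR
    (H := fun n l => ENNReal.ofReal (b * D) * (ENNReal.ofReal (if l ≤ 0 then 1 else 0) +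
      ENNReal.ofReal (if l ≤ 0 then 0 else F (n + 1) l)))
    (fun n => by
      have e0 : Measurable fun l : ℝ => if l ≤ 0 then (1 : ℝ) else 0 :=
        Measurable.ite hset measurable_const measurable_const
      have e1 : Measurable fun l : ℝ => if l ≤ 0 then 0 else F (n + 1) l :=
        Measurable.ite hset measurable_const (hm (n + 1))
      exact (e0.ennreal_ofReal.add e1.ennreal_ofReal).const_mul _)
    (fun n l hl => by
      simp only [if_pos hl, ENNReal.ofReal_one, ENNReal.ofReal_zero, add_zero, mul_one]
      exact ENNReal.ofReal_le_ofReal hb1)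
    (fun n hnT l hl hlC => by
      have h0 : ¬ l ≤ 0 := not_le.2 hl
      simp only [if_neg h0, ENNReal.ofReal_zero, zero_add]
      rw [← ENNReal.ofReal_mul hbD0]
      -- For `l < 1` the range bound suffices, as `d / l ≥ 1`; this avoids `log (1 / l)`, which no
      -- multiple of `log (2 d T)` controls. For `l ≥ 1` the logarithms are bounded by
      -- `momentBound_le`.
      rcases lt_or_ge l 1 with h1 | h1
      · refine (min_le_left _ _).trans (ENNReal.ofReal_le_ofReal (hb1.trans ?_))
        refine le_mul_of_one_le_right hbD0 ?_
        simp only [hF]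
        rw [one_le_div hl]
        linarith
      · refine (min_le_right _ _).trans (ENNReal.ofReal_le_ofReal ?_)
        have h2 := momentBound_le hE.dim_pos hT hCΓ Cσ.2 hE.one_le h1 hlC hnT.le
        have h3 := mul_le_mul_of_nonneg_left h2 hCr
        have h4 := mul_le_mul_of_nonneg_right hb2 (show 0 ≤ (d : ℝ) / l by positivity)
        refine h3.trans (le_trans (le_of_eq ?_) h4)
        rw [ha, hDdef]
        simp only [NNReal.val_eq_coe]
        ring)
  -- The additive constant is absorbed using `D ≥ log 2` here and `tZero ≥ 2` below.
  have hcoef : b * D + 4 * Cr * γbar ^ 2 ≤ regretConstant γbar rbar Cr CΓ Cσ * D := by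
    have := hdiv (4 * Cr * γbar ^ 2) (by positivity)
    rw [regretConstant, ← hb, add_mul, add_mul, abs_of_nonneg hCr]
    linarith
  have hsum : ∀ ω : Fin T → Round X A O, ∑ n ∈ Finset.range T, ENNReal.ofReal (b * D) *
      (ENNReal.ofReal (if lam Δ ω n ≤ 0 then 1 else 0) +
        ENNReal.ofReal (if lam Δ ω n ≤ 0 then 0 else F (n + 1) (lam Δ ω n))) +
      ENNReal.ofReal (4 * Cr * γbar ^ 2) ≤
      ENNReal.ofReal (regretConstant γbar rbar Cr CΓ Cσ * D) * ENNReal.ofReal ((tZero Δ ω : ℝ) +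
        ∑ t ∈ Finset.Icc (tZero Δ ω) T, F t (lam Δ ω (t - 1))) := fun ω => by
    have ht : (2 : ℝ) ≤ tZero Δ ω := by exact_mod_cast two_le_tZero hT ω
    have hS : 0 ≤ ∑ t ∈ Finset.Icc (tZero Δ ω) T, F t (lam Δ ω (t - 1)) := by
      rw [sum_Icc_tZero hE.dim_pos hO hT ω F]
      refine Finset.sum_nonneg fun n hn' => ?_
      split_ifs with h
      · exact le_rfl
      · exact hn n _ (not_le.1 h) (lam_le_mul hE hO hγ ω (Finset.mem_range.1 hn').le)
    have h4 : 0 ≤ 4 * Cr * γbar ^ 2 := by positivity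
    rw [← Finset.mul_sum, Finset.sum_add_distrib, sum_ofReal_tZero hT hE hO,
      sum_ofReal_Icc_tZero hT hE hO hγ hn, ← ENNReal.ofReal_add (by linarith) hS,
      ← ENNReal.ofReal_mul hbD0, ← ENNReal.ofReal_add (mul_nonneg hbD0 (by linarith)) h4,
      ← ENNReal.ofReal_mul (by linarith)]
    refine ENNReal.ofReal_le_ofReal ?_
    set S := ∑ t ∈ Finset.Icc (tZero Δ ω) T, F t (lam Δ ω (t - 1))
    have h5 := mul_le_mul_of_nonneg_right hcoef (show 0 ≤ (tZero Δ ω : ℝ) + S by linarith)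
    nlinarith
  have hint : ∫⁻ ω, ∑ n ∈ Finset.range T, ENNReal.ofReal (b * D) *
      (ENNReal.ofReal (if lam Δ ω n ≤ 0 then 1 else 0) +
        ENNReal.ofReal (if lam Δ ω n ≤ 0 then 0 else F (n + 1) (lam Δ ω n)))
          ∂(M.roundsLaw γ tf T) + ENNReal.ofReal (4 * Cr * γbar ^ 2) ≤
      ENNReal.ofReal (regretConstant γbar rbar Cr CΓ Cσ * D) *
        ∫⁻ ω, ENNReal.ofReal ((tZero Δ ω : ℝ) +
          ∑ t ∈ Finset.Icc (tZero Δ ω) T, F t (lam Δ ω (t - 1))) ∂(M.roundsLaw γ tf T) := by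
    rw [← lintegral_const_mul' _ _ ENNReal.ofReal_ne_top]
    refine le_trans (le_of_eq ?_) (lintegral_mono hsum)
    rw [lintegral_add_right _ measurable_const]
    simp
  refine (coe_le_add_of_ofReal_sub_le (key.trans hint)).trans (le_of_eq ?_)
  rw [coe_mul_expect (mul_nonneg (regretConstant_pos _ _ _ _ _).le hD0)]

end Assembly

end SeqDecision

theorem mainTheorem1 (γbar rbar Cr CΓ : ℝ) (Cσ : ℝ≥0) (hCΓ : 0 < CΓ) :
    ∃ c : ℝ, 0 < c ∧
      ∀ (d T : ℕ) (_ : 1 ≤ T)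
        (X A O : Type*) [MeasurableSpace X] [MeasurableSpace A] [MeasurableSpace O]
        (M : SeqDecision.Model d X A O)
        (astar : SeqDecision.Param d → X → A) (_ : M.IsOptimalAction astar)
        (dec : Set (Measure A)) (loss : Measure A → A → ℝ≥0∞)
        (algStar tf : SeqDecision.Policy X A O)
        (_ : ∀ n, IsMarkovKernel (algStar n)) (_ : ∀ n, IsMarkovKernel (tf n))
        (_ : M.IsBayesOptimal astar dec loss algStar)
        (Δ : X → A → Matrix (Fin d) (Fin d) ℝ) (ΔExploit : ℝ)
        (γ : SeqDecision.Param d) (_ : γ ∈ M.Γ)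
        (_ : SeqDecision.EnvironmentSpace M γbar rbar)
        (_ : SeqDecision.ObservationModel M γ Δ Cσ CΓ)
        (_ : SeqDecision.RewardGaps M γ astar algStar tf T ΔExploit Cr),
        ((M.regret astar tf γ T : ℝ) : EReal) ≤
            ((ΔExploit * T : ℝ) : EReal)
            + (rbar : EReal) * SeqDecision.expect (M.roundsLaw γ tf T)
                (fun ω => (SeqDecision.tZero Δ ω : ℝ) - 1)
            + (Cr : EReal) * SeqDecision.expect (M.roundsLaw γ tf T)
                (fun ω => ∑ t ∈ Finset.Icc (SeqDecision.tZero Δ ω) T,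
                  SeqDecision.epsT d γbar CΓ t (SeqDecision.lam Δ ω (t - 1)))
            + ((16 * Cr * (4 * Cσ + 1) : ℝ) : EReal) *
                SeqDecision.expect (M.roundsLaw γ tf T)
                (fun ω => ∑ t ∈ Finset.Icc (SeqDecision.tZero Δ ω) T,
                  Real.log (2 * SeqDecision.coverT d γbar CΓ t (SeqDecision.lam Δ ω (t - 1)) * T)
                    / SeqDecision.lam Δ ω (t - 1))
            + ((4 * Cr * γbar ^ 2 : ℝ) : EReal)
        ∧ ((M.regret astar tf γ T : ℝ) : EReal) ≤
            ((ΔExploit * T : ℝ) : EReal)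
            + ((c * Real.log (2 * d * T) : ℝ) : EReal) *
                SeqDecision.expect (M.roundsLaw γ tf T)
                (fun ω => (SeqDecision.tZero Δ ω : ℝ) +
                  ∑ t ∈ Finset.Icc (SeqDecision.tZero Δ ω) T,
                    (d : ℝ) / SeqDecision.lam Δ ω (t - 1)) := by
  -- The constant is built with `|rbar|` and `|Cr|`: it is chosen before any model is given, and
  -- only a model forces both to be nonnegative.
  refine ⟨SeqDecision.regretConstant γbar rbar Cr CΓ Cσ,
    SeqDecision.regretConstant_pos γbar rbar Cr CΓ Cσ, ?_⟩
  intro d T hT X A O _ _ _ M astar hopt dec loss algStar tf _ _ _ Δ ΔExploit γ hγ hE hO hR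
  exact ⟨SeqDecision.regret_le_explicit hT hopt hE hO hγ hR,
    SeqDecision.regret_le_order hT hCΓ hopt hE hO hγ hR⟩
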